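/- For a word $w=w_1\cdots w_n$ over $\mathbb{Z}$, the reduction $\mathrm{red}(w)$ (resp. positive reduction $\mathrm{red}^+(w)$) is obtained from $w$ by replacing, for all $i$, every occurrence of the $i$-th smallest letter (resp. $i$-th smallest positive letter, the non-positive letters being left unchanged) of $w$ by $i$. A $1$-arrangement of $[n]=\{1,\ldots,n\}$ is a permutation $\pi\in\mathfrak{S}_n$ all of whose fixed points carry the single colour $-1$; its derangement form is the word obtained from $\pi(1)\cdots\pi(n)$ by replacing $\pi(i)$ by $-1$ for each fixed point $i$ of $\pi$ and then applying $\mathrm{red}^+$. Let $\mathcal{D}_n^1$ be the set of derangement forms of all $1$-arrangements of $[n]$, and for a permutation $\sigma\in\mathfrak{S}_3$ let $\mathcal{D}_n^1(\sigma)$ be the set of words $w\in\mathcal{D}_n^1$ that avoid $\sigma$, i.e. for which there are no $i_1<i_2<i_3$ with $\mathrm{red}(w_{i_1}w_{i_2}w_{i_3})=\sigma$. **Theorem.** For every $n\ge 1$, $|\mathcal{D}_n^1(321)|=|\mathcal{D}_n^1(132)|$; in other words, the patterns $321$ and $132$ are Wilf-equivalent on $1$-arrangements in derangement form. Moreover,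 as formal series in $x$ over $\mathbb{Q}$, with $\sqrt{1-4x}$ the square root of $1-4x$ with constant term $1$, $$1+\sum_{n\ge1}|\mathcal{D}_n^1(321)|\,x^n=\frac{1-3x+3x^2+2x^3+(x^2+x-1)\sqrt{1-4x}}{2x^2(1-x)(2+x)}.$$ -/

import Mathlib

/-- A `k`-arrangement of `[n]`: a permutation `π` together with an arbitrary function `φ` from the
fixed points of `π` to the set `{-k, …, -2, -1}` of negative letters.
The set `[n]` is modelled by `Fin n`, the element `i : Fin n` standing for the number `i + 1`. -/
abbrev KArrangement (k n : ℕ) : Type :=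
  (π : Equiv.Perm (Fin n)) × (Function.fixedPoints π → Set.Icc (-(k : ℤ)) (-1))

/-- The reduction of a word `w` over the integers: every occurrence of the `j`-th smallest of the
(distinct) letters of `w` is replaced by `j`. A letter `a` of `w` is the `j`-th smallest one exactly
when `j` distinct letters of `w` are at most `a`. -/
def wordRed {n : ℕ} (w : Fin n → ℤ) : Fin n → ℤ :=
  fun i => (((Finset.univ.image w).filter (fun a => a ≤ w i)).card : ℤ)

/-- The positive reduction of a word `w` over the integers: every occurrence of the `j`-th smallest
of the (distinct) positive letters of `w` is replaced by `j`; all other letters are kept. -/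
def wordPosRed {n : ℕ} (w : Fin n → ℤ) : Fin n → ℤ :=
  fun i =>
    if 0 < w i then (((Finset.univ.image w).filter (fun a => 0 < a ∧ a ≤ w i)).card : ℤ) else w i

/-- The derangement form of a `k`-arrangement `(π, φ)`: in the word `π(1) π(2) ⋯ π(n)` change
`π(i)` to `φ(i)` for every fixed point `i`, and then apply the positive reduction. -/
def derangementForm {k n : ℕ} (a : KArrangement k n) : Fin n → ℤ :=
  wordPosRed (fun i => if h : a.1 i = i then (a.2 ⟨i, h⟩ : ℤ) else ((a.1 i : ℕ) : ℤ) + 1)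

/-- The set of the derangement forms of all `k`-arrangements of `[n]`. -/
def derangementForms (k n : ℕ) : Set (Fin n → ℤ) :=
  Set.range (derangementForm : KArrangement k n → Fin n → ℤ)

/-- The word `w` avoids the pattern `σ` (a permutation of `{1, …, m}` in one-line notation): there
are no positions `f 0 < f 1 < ⋯ < f (m - 1)` such that the corresponding subword of `w` reduces to
`σ`. -/
def AvoidsPattern {n m : ℕ} (w : Fin n → ℤ) (σ : Fin m → ℤ) : Prop :=
  ¬ ∃ f : Fin m → Fin n, StrictMono f ∧ wordRed (fun j => w (f j)) = σ

/-- The set of the words in `W` that avoid the pattern `σ`. -/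
def avoiders {n m : ℕ} (W : Set (Fin n → ℤ)) (σ : Fin m → ℤ) : Set (Fin n → ℤ) :=
  {w | w ∈ W ∧ AvoidsPattern w σ}

/-- Two patterns are Wilf-equivalent over `W` if equally many words of `W` avoid them. -/
def WilfEquivalent {n m : ℕ} (W : Set (Fin n → ℤ)) (σ τ : Fin m → ℤ) : Prop :=
  (avoiders W σ).ncard = (avoiders W τ).ncard

/-- There are finitely many derangement forms, so `Set.ncard` counts them and their subsets. -/
theorem derangementForms_finite (k n : ℕ) : (derangementForms k n).Finite :=
  Set.finite_range _

/-- The generating function `1 + ∑_{n ≥ 1} c n * X ^ n`, as a formal power series over `ℚ`. -/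
noncomputable def genFun (c : ℕ → ℕ) : PowerSeries ℚ :=
  PowerSeries.mk (fun n => if n = 0 then 1 else (c n : ℚ))

/-!
The word of a `1`-arrangement consists of a derangement `f` of `m` letters, spread over `m` of the
`n` positions, and of `k = n - m` letters `-1`. A letter `-1` can only play the part of the smallest
letter of a pattern, so such a word avoids `321` exactly when `f` does and the letters of `f` in
front of the last `-1` increase; that is, when all letters `-1` are among the first `L f + k`
positions, where `L f` is the length of the initial increasing run of `f`. For `132`, the letters
of `f` after the first `-1` have to increase, and the final increasing run takes the place of the
initial one. In both cases the number of words is the sum of `(L f + k).choose k`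
over the derangements `f` that avoid the pattern (`ncard_avoiders_321`, `ncard_avoiders_132`).

Both classes of permutations, with their statistics `L`, admit the same two decompositions
(`RunDecomposition`):

* Removing the smallest letter turns a permutation of `n + 1` letters into a permutation `g` of `n`
  letters. It can be put back in `L g + 1` ways, and the resulting values of `L` are
  `1, …, L g + 1`.
* A permutation that is not a derangement splits at a fixed point into a derangement `a`, the
  fixed point, and an arbitrary permutation `b` of the class; unless `a` is empty, `L` is inherited
  from `a`. For `321` the permutation is the direct sum of the part before the first fixed point,
  this point, and the part after it. For `132` the last fixed point `i` is the upper right corner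
  of a square block `[p, i] × [p, i]` that consists of `i` and the smaller letters in front of it;
  cutting out the block leaves the derangement `a`, from which `p` can be read off (`cutPoint`).

The first decomposition shows that the sum of `x ^ n * (1 - x) ^ (-L f - 1)` over the class is
`(c - 1) / x`, where `c = 1 + x * c ^ 2` is the Catalan series, and that the class has Catalan many
members. The second one then determines the same sum over the derangements of the class, which is
the generating function of the words. So both patterns have the same generating function, and the
closed form follows with `s = 1 - 2 * x * c`.
-/

/-! ### Generating functions of statistics with geometric weights -/

section GeneratingFunction

open PowerSeries Finset

/-- For a sequence `P` of power series, the power series `∑ m, X ^ m * P m`. -/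
noncomputable def diagSum (P : ℕ → PowerSeries ℚ) : PowerSeries ℚ :=
  PowerSeries.mk fun n => ∑ p ∈ antidiagonal n, coeff p.2 (P p.1)

lemma coeff_diagSum (P : ℕ → PowerSeries ℚ) (n : ℕ) :
    coeff n (diagSum P) = ∑ p ∈ antidiagonal n, coeff p.2 (P p.1) :=
  coeff_mk _ _

lemma diagSum_add (P Q : ℕ → PowerSeries ℚ) :
    diagSum (fun m => P m + Q m) = diagSum P + diagSum Q := by
  ext n
  simp [coeff_diagSum, sum_add_distrib]

lemma diagSum_sub (P Q : ℕ → PowerSeries ℚ) :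
    diagSum (fun m => P m - Q m) = diagSum P - diagSum Q := by
  ext n
  simp [coeff_diagSum, sum_sub_distrib]

lemma diagSum_mul_left (u : PowerSeries ℚ) (P : ℕ → PowerSeries ℚ) :
    diagSum (fun m => u * P m) = u * diagSum P := by
  ext n
  simp only [coeff_diagSum, coeff_mul, mul_sum, sum_sigma']
  refine sum_nbij' (fun x => ⟨(x.2.1, x.1.1 + x.2.2), (x.1.1, x.2.2)⟩)
    (fun x => ⟨(x.2.1, x.1.1 + x.2.2), (x.1.1, x.2.2)⟩) ?_ ?_ ?_ ?_ ?_ <;>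
  · rintro ⟨⟨a, b⟩, ⟨c, d⟩⟩
    grind [HasAntidiagonal.mem_antidiagonal]

lemma diagSum_convolution (c : ℕ → ℚ) (P : ℕ → PowerSeries ℚ) :
    diagSum (fun m => ∑ p ∈ antidiagonal m, C (c p.2) * P p.1) =
      PowerSeries.mk c * diagSum P := by
  ext n
  simp only [coeff_diagSum, coeff_mul n, map_sum, coeff_C_mul, coeff_mk, mul_sum, sum_sigma']
  refine sum_nbij' (fun x => ⟨(x.2.2, x.2.1 + x.1.2), (x.2.1, x.1.2)⟩)
    (fun x => ⟨(x.2.1 + x.1.1, x.2.2), (x.2.1, x.1.1)⟩) ?_ ?_ ?_ ?_ ?_ <;>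
  · rintro ⟨⟨a, b⟩, ⟨c, d⟩⟩
    grind [HasAntidiagonal.mem_antidiagonal]

lemma diagSum_C (c : ℕ → ℚ) : diagSum (fun m => C (c m)) = PowerSeries.mk c := by
  ext n
  rw [coeff_diagSum, coeff_mk, sum_eq_single (n, 0)]
  · simp
  · rintro ⟨a, b⟩ h h'
    rw [coeff_C, if_neg]
    grind [HasAntidiagonal.mem_antidiagonal]
  · simp

lemma diagSum_succ (P : ℕ → PowerSeries ℚ) :
    diagSum P = P 0 + X * diagSum (fun m => P (m + 1)) := by
  ext n
  cases n with
  | zero => simp [coeff_diagSum]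
  | succ n => simp [coeff_diagSum, coeff_succ_X_mul, Nat.sum_antidiagonal_succ]

/-- The geometric series `1 / (1 - X)`. -/
noncomputable def geomSeries : PowerSeries ℚ := PowerSeries.mk 1

lemma geomSeries_mul : geomSeries * (1 - X) = 1 := mk_one_mul_one_sub_eq_one ℚ

lemma constantCoeff_geomSeries : constantCoeff geomSeries = 1 := by
  simp [geomSeries, ← coeff_zero_eq_constantCoeff_apply]

lemma coeff_geomSeries_pow (l k : ℕ) :
    coeff k (geomSeries ^ (l + 1)) = ((l + k).choose k : ℚ) := by
  rw [geomSeries, mk_one_pow_eq_mk_choose_add, coeff_mk, Nat.choose_symm_add]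

lemma geomSeries_sum (L : ℕ) :
    X * (1 - X) * ∑ l ∈ range (L + 1), geomSeries ^ (l + 1 + 1) = geomSeries ^ (L + 1) - 1 := by
  have h := geomSeries_mul
  induction L with
  | zero =>
    simp only [zero_add, sum_range_one]
    linear_combination (geomSeries * X - 1) * h
  | succ L ih =>
    rw [sum_range_succ, mul_add, ih]
    linear_combination (geomSeries ^ (L + 2) * X - geomSeries ^ (L + 1)) * h

/-- The generating function of the Catalan numbers, with rational coefficients. -/
noncomputable def catalanGF : PowerSeries ℚ := map (Nat.castRingHom ℚ) catalanSeries

lemma catalanGF_eq : catalanGF = 1 + X * catalanGF ^ 2 := by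
  have h := congrArg (map (Nat.castRingHom ℚ)) catalanSeries_sq_mul_X_add_one
  simp only [map_add, map_mul, map_pow, map_X, map_one] at h
  rw [catalanGF]
  linear_combination -h

lemma constantCoeff_catalanGF : constantCoeff catalanGF = 1 := by
  rw [catalanGF_eq]; simp

/-- The number of words made of an element `f` of some `G m` and `n - m` further letters that have
to be among the first (or last) `L f + (n - m)` positions. -/
def wordCount {α : Type*} (G : ℕ → Finset α) (L : ℕ → α → ℕ) (n : ℕ) : ℕ :=
  ∑ p ∈ antidiagonal n, ∑ f ∈ G p.1, (L p.1 f + p.2).choose p.2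

lemma mk_wordCount {α : Type*} (G : ℕ → Finset α) (L : ℕ → α → ℕ) :
    PowerSeries.mk (fun n => (wordCount G L n : ℚ)) =
      diagSum (fun n => ∑ f ∈ G n, geomSeries ^ (L n f + 1)) := by
  ext n
  simp [wordCount, coeff_diagSum, coeff_geomSeries_pow]

/-- Two sequences `S`, `G` of finite sets with a statistic `L` on their elements, subject to the
two decompositions that permutations avoiding a pattern (`S n`), the derangements among them
(`G n`), and the length of the initial or final increasing run (`L`) have in common.
`sum_succ` says that the elements of `S (n + 1)` arise from those `f` of `S n` by `L f + 1`
insertions, which produce the values `1, …, L f + 1` of the statistic. `sum_eq_derangements` says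
that an element of `S (n + 1)` outside `G (n + 1)` is made of a marked point, an `α ∈ G i` and
a `β ∈ S j` with `i + j = n`, the statistic being inherited from `α` unless `i = 0`. -/
structure RunDecomposition {α : Type*} (S G : ℕ → Finset α) (L : ℕ → α → ℕ) : Prop where
  zero : ∃ e, S 0 = {e} ∧ G 0 = {e} ∧ L 0 e = 0
  sum_succ : ∀ (n : ℕ) (φ : ℕ → PowerSeries ℚ),
    ∑ f ∈ S (n + 1), φ (L (n + 1) f) = ∑ f ∈ S n, ∑ l ∈ range (L n f + 1), φ (l + 1)
  sum_eq_derangements : ∀ (n : ℕ) (φ : ℕ → PowerSeries ℚ),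
    ∑ f ∈ S (n + 1), φ (L (n + 1) f) = ∑ f ∈ G (n + 1), φ (L (n + 1) f) +
      ∑ p ∈ antidiagonal n, ∑ a ∈ G p.1, ∑ b ∈ S p.2,
        φ (if p.1 = 0 then L p.2 b + 1 else L p.1 a)

namespace RunDecomposition

variable {α : Type*} {S G : ℕ → Finset α} {L : ℕ → α → ℕ}

lemma sum_geomSeries_zero (h : RunDecomposition S G L) :
    ∑ f ∈ S 0, geomSeries ^ (L 0 f + 1) = geomSeries := by
  obtain ⟨e, hS, -, hL⟩ := h.zero
  simp [hS, hL]

/-- Since the values `1, …, L f + 1` form a geometric sum, inserting a letter acts on the power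
series `∑ f ∈ S n, (1 - X) ^ (-L f - 1)` as an affine map. -/
lemma sum_geomSeries_succ (h : RunDecomposition S G L) (n : ℕ) :
    X * (1 - X) * ∑ f ∈ S (n + 1), geomSeries ^ (L (n + 1) f + 1) =
      (∑ f ∈ S n, geomSeries ^ (L n f + 1)) - C (#(S n) : ℚ) := by
  rw [h.sum_succ n (fun l => geomSeries ^ (l + 1)), mul_sum, sum_congr rfl fun f _ =>
    geomSeries_sum (L n f)]
  simp

/-- The recursion of `sum_geomSeries_succ` is the one satisfied by the coefficients of the powers
of the Catalan series `c = 1 + X * c ^ 2`. -/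
lemma coeff_sum_geomSeries (h : RunDecomposition S G L) (n k : ℕ) :
    coeff k (∑ f ∈ S n, geomSeries ^ (L n f + 1)) = coeff n (catalanGF ^ (k + 1)) := by
  induction n generalizing k with
  | zero =>
    rw [h.sum_geomSeries_zero]
    simp [geomSeries, constantCoeff_catalanGF]
  | succ n ih =>
    have step := h.sum_geomSeries_succ n
    induction k with
    | zero =>
      have h1 := congrArg (coeff 1) step
      rw [mul_assoc, ← zero_add 1, coeff_succ_X_mul, map_sub, ih, sub_mul, map_sub] at h1
      simp only [one_mul, coeff_zero_X_mul, coeff_C, zero_add, one_ne_zero, if_false,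
        sub_zero] at h1
      have h2 := congrArg (coeff (n + 1)) catalanGF_eq
      rw [map_add, coeff_succ_X_mul, coeff_one, if_neg n.succ_ne_zero, zero_add] at h2
      rw [h1, zero_add, pow_one, h2]
    | succ k ihk =>
      have h1 := congrArg (coeff (k + 2)) step
      rw [mul_assoc, coeff_succ_X_mul, map_sub, ih, sub_mul, map_sub, one_mul,
        coeff_succ_X_mul, ihk, coeff_C, if_neg (by omega), sub_zero] at h1
      have h2 : catalanGF ^ (k + 2) = catalanGF ^ (k + 1) + X * catalanGF ^ (k + 3) := by
        linear_combination catalanGF ^ (k + 1) * catalanGF_eq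
      have h3 := congrArg (coeff (n + 1)) h2
      rw [map_add, coeff_succ_X_mul] at h3
      rw [h3]
      linear_combination h1

lemma mk_card_eq (h : RunDecomposition S G L) :
    PowerSeries.mk (fun n => (#(S n) : ℚ)) = catalanGF := by
  ext n
  have := h.coeff_sum_geomSeries n 0
  simpa [coeff_geomSeries_pow, constantCoeff_geomSeries] using this

lemma X_mul_diagSum (h : RunDecomposition S G L) :
    X * diagSum (fun n => ∑ f ∈ S n, geomSeries ^ (L n f + 1)) = catalanGF - 1 := by
  set Q := fun n => ∑ f ∈ S n, geomSeries ^ (L n f + 1) with hQ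
  have h0 : Q 0 = geomSeries := h.sum_geomSeries_zero
  have h1 : X * (1 - X) * diagSum (fun n => Q (n + 1)) = diagSum Q - catalanGF := by
    rw [← diagSum_mul_left, ← h.mk_card_eq, ← diagSum_C, ← diagSum_sub]
    exact congrArg diagSum (funext h.sum_geomSeries_succ)
  have h2 := diagSum_succ Q
  rw [h0] at h2
  linear_combination (X - 1) * h2 - h1 - geomSeries_mul

lemma sum_geomSeries_eq_derangements (h : RunDecomposition S G L) (n : ℕ) :
    ∑ f ∈ S (n + 1), geomSeries ^ (L (n + 1) f + 1) + C (#(S n) : ℚ) * geomSeries =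
      ∑ f ∈ G (n + 1), geomSeries ^ (L (n + 1) f + 1) +
      ∑ p ∈ antidiagonal n, C (#(S p.2) : ℚ) * ∑ f ∈ G p.1, geomSeries ^ (L p.1 f + 1) +
      geomSeries * ∑ f ∈ S n, geomSeries ^ (L n f + 1) := by
  obtain ⟨e, hS, hG, hL⟩ := h.zero
  rw [h.sum_eq_derangements n (fun l => geomSeries ^ (l + 1))]
  cases n with
  | zero =>
    simp [hS, hG, hL]
    ring
  | succ n =>
    simp only [Nat.sum_antidiagonal_succ, hG, hL, sum_singleton, if_true, Nat.succ_ne_zero,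
      if_false, sum_const, pow_succ, nsmul_eq_mul, map_natCast, card_singleton,
      Nat.cast_one, mul_sum]
    ring_nf

/-- The second decomposition relates the weighted sum over `G` to the one over `S`, which is known
by `X_mul_diagSum`. -/
theorem diagSum_derangements (h : RunDecomposition S G L) :
    X * (1 - X) * (1 + X * catalanGF) *
      diagSum (fun n => ∑ f ∈ G n, geomSeries ^ (L n f + 1)) =
      (1 - 2 * X) * (catalanGF - 1) + X ^ 2 * catalanGF := by
  set Q := fun n => ∑ f ∈ S n, geomSeries ^ (L n f + 1) with hQ
  set P := fun n => ∑ f ∈ G n, geomSeries ^ (L n f + 1) with hP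
  have hQ0 : Q 0 = geomSeries := h.sum_geomSeries_zero
  have hP0 : P 0 = geomSeries := by
    obtain ⟨e, -, hG, hL⟩ := h.zero
    simp [hP, hG, hL]
  have hV : X * diagSum Q = catalanGF - 1 := h.X_mul_diagSum
  have h1 : diagSum (fun n => Q (n + 1)) + geomSeries * catalanGF =
      diagSum (fun n => P (n + 1)) + catalanGF * diagSum P + geomSeries * diagSum Q := by
    rw [← h.mk_card_eq, ← diagSum_convolution, ← diagSum_C, ← diagSum_mul_left,
      ← diagSum_mul_left, ← diagSum_add, ← diagSum_add, ← diagSum_add]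
    refine congrArg diagSum (funext fun n => ?_)
    rw [mul_comm geomSeries (C _)]
    exact h.sum_geomSeries_eq_derangements n
  have h2 := diagSum_succ Q
  have h3 := diagSum_succ P
  rw [hQ0] at h2
  rw [hP0] at h3
  have hq := geomSeries_mul
  linear_combination (X ^ 2 - X) * (h2 - h3) - X ^ 2 * (1 - X) * h1 + (1 - 2 * X) * hV +
    (X ^ 2 * catalanGF - X ^ 2 * diagSum Q) * hq

/-- For `n = 0` the count agrees with the constant term of `genFun`. -/
lemma wordCount_zero (h : RunDecomposition S G L) : wordCount G L 0 = 1 := by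
  obtain ⟨e, -, hG, hL⟩ := h.zero
  simp [wordCount, hG]

/-- The count of words depends only on the two decompositions. -/
theorem wordCount_unique {β : Type*} {S' G' : ℕ → Finset β} {L' : ℕ → β → ℕ}
    (h : RunDecomposition S G L) (h' : RunDecomposition S' G' L') (n : ℕ) :
    wordCount G L n = wordCount G' L' n := by
  have h1 := h.diagSum_derangements.trans h'.diagSum_derangements.symm
  have hne : (X * (1 - X) * (1 + X * catalanGF) : PowerSeries ℚ) ≠ 0 := by
    refine mul_ne_zero (mul_ne_zero X_ne_zero fun h0 => ?_) fun h0 => ?_ <;>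
    simpa using congrArg constantCoeff h0
  have h2 := mul_left_cancel₀ hne h1
  rw [← mk_wordCount, ← mk_wordCount] at h2
  have h3 := congrArg (coeff n) h2
  simpa using h3

/-- With `s = 1 - 2 * X * catalanGF`, the factor `1 + X * catalanGF = (3 - s) / 2` is removed by
means of `(3 - s) * (3 + s) = 4 * (2 + X)`. -/
theorem wordCount_series (h : RunDecomposition S G L) :
    ∃ s : PowerSeries ℚ, constantCoeff s = 1 ∧ s ^ 2 = 1 - 4 * X ∧
      PowerSeries.mk (fun n => (wordCount G L n : ℚ)) *
        (2 * X ^ 2 * (1 - X) * (2 + X)) =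
      1 - 3 * X + 3 * X ^ 2 + 2 * X ^ 3 + (X ^ 2 + X - 1) * s := by
  have hc := catalanGF_eq
  refine ⟨1 - 2 * X * catalanGF, by simp, by linear_combination (-4 * X) * hc, ?_⟩
  rw [mk_wordCount]
  linear_combination 2 * X * (2 - X * catalanGF) * h.diagSum_derangements +
    (2 * X - 4 * X ^ 2 + 2 * X ^ 3 - 2 * X ^ 3 * (1 - X) *
      diagSum (fun n => ∑ f ∈ G n, geomSeries ^ (L n f + 1))) * hc

end RunDecomposition

end GeneratingFunction

/-! ### Permutations as functions on the natural numbers -/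

section Permutations

open Finset Function

/-- The permutations of `{0, …, n - 1}`, encoded as the injective functions `ℕ → ℕ` that are the
identity from `n` on. -/
def permSet (n : ℕ) : Set (ℕ → ℕ) := {f | Injective f ∧ ∀ i, n ≤ i → f i = i}

lemma lt_of_mem_permSet {n : ℕ} {f : ℕ → ℕ} (hf : f ∈ permSet n) {i : ℕ} (hi : i < n) :
    f i < n := by
  by_contra h
  have h1 := hf.2 (f i) (by omega)
  have h2 := hf.1 h1
  omega

lemma permSet_finite (n : ℕ) : (permSet n).Finite := by
  refine (Set.finite_range fun (g : Fin n → Fin n) (i : ℕ) =>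
    if h : i < n then (g ⟨i, h⟩ : ℕ) else i).subset fun f hf => ?_
  refine ⟨fun i => ⟨f i, lt_of_mem_permSet hf i.2⟩, ?_⟩
  funext i
  by_cases h : i < n
  · simp [h]
  · simp [h, hf.2 i (by omega)]

lemma exists_preimage {s : Finset ℕ} {f : ℕ → ℕ} (hf : Injective f) (h : ∀ x ∈ s, f x ∈ s) :
    ∀ y ∈ s, ∃ x ∈ s, f x = y := by
  intro y hy
  have : s.image f = s := eq_of_subset_of_card_le (by grind) (by rw [card_image_of_injective _ hf])
  rw [← this] at hy
  simpa using hy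

lemma mapsTo_of_exists_preimage {s : Finset ℕ} {f : ℕ → ℕ} (h : ∀ y ∈ s, ∃ x ∈ s, f x = y) :
    ∀ x ∈ s, f x ∈ s := by
  intro x hx
  have : s = s.image f := eq_of_subset_of_card_le
    (fun y hy => by obtain ⟨x, hx, rfl⟩ := h y hy; exact mem_image_of_mem f hx) card_image_le
  rw [this]
  exact mem_image_of_mem f hx

lemma surjective_of_mem_permSet {n : ℕ} {f : ℕ → ℕ} (hf : f ∈ permSet n) (v : ℕ) :
    ∃ i, f i = v := by
  by_cases hv : v < n
  · obtain ⟨i, -, h⟩ := exists_preimage (s := range n) hf.1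
      (fun x hx => mem_range.2 (lt_of_mem_permSet hf (mem_range.1 hx))) v (mem_range.2 hv)
    exact ⟨i, h⟩
  · exact ⟨v, hf.2 v (by omega)⟩

open Classical in
/-- The permutations of `{0, …, n - 1}` that satisfy `A`. -/
noncomputable def permsWith (A : (ℕ → ℕ) → Prop) (n : ℕ) : Finset (ℕ → ℕ) :=
  (permSet_finite n).toFinset.filter A

open Classical in
/-- The derangements of `{0, …, n - 1}` that satisfy `A`. -/
noncomputable def derangementsWith (A : (ℕ → ℕ) → Prop) (n : ℕ) : Finset (ℕ → ℕ) :=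
  (permsWith A n).filter fun f => ∀ i < n, f i ≠ i

lemma mem_permsWith {A : (ℕ → ℕ) → Prop} {n : ℕ} {f : ℕ → ℕ} :
    f ∈ permsWith A n ↔ f ∈ permSet n ∧ A f := by
  simp [permsWith]

lemma mem_derangementsWith {A : (ℕ → ℕ) → Prop} {n : ℕ} {f : ℕ → ℕ} :
    f ∈ derangementsWith A n ↔ f ∈ permSet n ∧ A f ∧ ∀ i < n, f i ≠ i := by
  simp [derangementsWith, mem_permsWith, and_assoc]

lemma permSet_zero : permSet 0 = {id} := by
  ext f
  simp only [permSet, Set.mem_ofPred_eq, Set.mem_singleton_iff]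
  exact ⟨fun h => funext fun i => h.2 i i.zero_le, fun h => by subst h; simp [injective_id]⟩

lemma permsWith_zero {A : (ℕ → ℕ) → Prop} (h : A id) : permsWith A 0 = {id} := by
  ext f
  rw [mem_permsWith, permSet_zero]
  simp +contextual [h]

lemma derangementsWith_zero {A : (ℕ → ℕ) → Prop} (h : A id) : derangementsWith A 0 = {id} := by
  ext f
  rw [mem_derangementsWith, permSet_zero]
  simp +contextual [h]

/-- `f` has no decreasing subsequence of length three. For `f ∈ permSet n` it makes no difference
that positions from `n` on are allowed, since `f` has its larger letters there, in increasing
order. -/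
def Avoids321 (f : ℕ → ℕ) : Prop := ∀ i j k, i < j → j < k → ¬ (f k < f j ∧ f j < f i)

/-- `f` has no subsequence with the relative order of `132`. As for `Avoids321`, positions beyond
the size of a permutation do not matter. -/
def Avoids132 (f : ℕ → ℕ) : Prop := ∀ i j k, i < j → j < k → ¬ (f i < f k ∧ f k < f j)

/-! ### Insertion of the letter `0` -/

/-- Raise all letters by one and insert the letter `0` at position `p`. -/
def insertZero (p : ℕ) (g : ℕ → ℕ) : ℕ → ℕ :=
  fun i => if i < p then g i + 1 else if i = p then 0 else g (i - 1) + 1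

/-- Remove the letter `0`, which is at position `p`, and lower the other letters by one. -/
def removeZero (p : ℕ) (f : ℕ → ℕ) : ℕ → ℕ :=
  fun i => if i < p then f i - 1 else f (i + 1) - 1

lemma insertZero_mem {n p : ℕ} {g : ℕ → ℕ} (hg : g ∈ permSet n) (hp : p ≤ n) :
    insertZero p g ∈ permSet (n + 1) := by
  refine ⟨fun i j h => ?_, fun i hi => ?_⟩
  · have h1 : ∀ a b, g a = g b → a = b := fun a b h => hg.1 h
    have h2 := h1 i j
    have h3 := h1 i (j - 1)
    have h4 := h1 (i - 1) j
    have h5 := h1 (i - 1) (j - 1)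
    unfold insertZero at h
    split_ifs at h <;> omega
  · have := hg.2 (i - 1) (by omega)
    unfold insertZero
    split_ifs <;> omega

lemma invFun_zero_le {n : ℕ} {f : ℕ → ℕ} (hf : f ∈ permSet (n + 1)) :
    f (invFun f 0) = 0 ∧ invFun f 0 ≤ n := by
  have h0 : f (invFun f 0) = 0 := invFun_eq (surjective_of_mem_permSet hf 0)
  refine ⟨h0, ?_⟩
  by_contra h
  have := hf.2 (invFun f 0) (by omega)
  omega

lemma insertZero_removeZero {p : ℕ} {f : ℕ → ℕ} (hf : Injective f) (hp : f p = 0) :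
    insertZero p (removeZero p f) = f := by
  funext i
  have h1 : i ≠ p → f i ≠ 0 := fun h h' => h (hf (h'.trans hp.symm))
  unfold insertZero removeZero
  split_ifs with h2 h3 h4
  · have := h1 (by omega); omega
  · rw [h3, hp]
  · omega
  · have := h1 h3
    rw [show i - 1 + 1 = i by omega]
    omega

lemma removeZero_mem {n p : ℕ} {f : ℕ → ℕ} (hf : f ∈ permSet (n + 1)) (hp : f p = 0) (hpn : p ≤ n) :
    removeZero p f ∈ permSet n := by
  have h1 : ∀ i, i ≠ p → f i ≠ 0 := fun i h h' => h (hf.1 (h'.trans hp.symm))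
  have h2 : ∀ a b, f a = f b → a = b := fun a b h => hf.1 h
  refine ⟨fun i j h => ?_, fun i hi => ?_⟩
  · have hi := h1 i
    have hj := h1 j
    have hi' := h1 (i + 1)
    have hj' := h1 (j + 1)
    have h3 := h2 i j
    have h4 := h2 i (j + 1)
    have h5 := h2 (i + 1) j
    have h6 := h2 (i + 1) (j + 1)
    unfold removeZero at h
    split_ifs at h <;> omega
  · have := hf.2 (i + 1) (by omega)
    unfold removeZero
    split_ifs <;> omega

lemma removeZero_insertZero (p : ℕ) (g : ℕ → ℕ) : removeZero p (insertZero p g) = g := by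
  funext i
  by_cases h : i < p
  · simp [insertZero, removeZero, h]
  · simp [insertZero, removeZero, h, show ¬ i + 1 < p by omega, show i + 1 ≠ p by omega]

lemma invFun_insertZero {n p : ℕ} {g : ℕ → ℕ} (hg : g ∈ permSet n) (hp : p ≤ n) :
    invFun (insertZero p g) 0 = p := by
  have h := insertZero_mem hg hp
  refine h.1 ((invFun_zero_le h).1.trans ?_)
  simp [insertZero]

/-- If `0` may be inserted into `g` exactly at the positions in `J g`, then summing over the larger
permutations amounts to summing over all permissible insertions. -/
lemma sum_permsWith_succ {A : (ℕ → ℕ) → Prop} {n : ℕ} {J : (ℕ → ℕ) → Finset ℕ}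
    {M : Type*} [AddCommMonoid M] (ψ : (ℕ → ℕ) → M) (hJ : ∀ g ∈ permSet n, ∀ p ∈ J g, p ≤ n)
    (h : ∀ g ∈ permSet n, ∀ p ≤ n, A (insertZero p g) ↔ A g ∧ p ∈ J g) :
    ∑ f ∈ permsWith A (n + 1), ψ f =
      ∑ g ∈ permsWith A n, ∑ p ∈ J g, ψ (insertZero p g) := by
  rw [sum_sigma']
  refine sum_nbij' (fun f => ⟨removeZero (invFun f 0) f, invFun f 0⟩)
    (fun x => insertZero x.2 x.1) ?_ ?_ ?_ ?_ ?_
  · intro f hf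
    rw [mem_permsWith] at hf
    obtain ⟨h0, hn⟩ := invFun_zero_le hf.1
    have hr := removeZero_mem hf.1 h0 hn
    have hi := insertZero_removeZero hf.1.1 h0
    have hA := (h _ hr _ hn).1 (by rw [hi]; exact hf.2)
    exact mem_sigma.2 ⟨mem_permsWith.2 ⟨hr, hA.1⟩, hA.2⟩
  · rintro ⟨g, p⟩ hx
    obtain ⟨hg, hp⟩ := mem_sigma.1 hx
    rw [mem_permsWith] at hg
    have hn := hJ g hg.1 p hp
    exact mem_permsWith.2 ⟨insertZero_mem hg.1 hn, (h g hg.1 p hn).2 ⟨hg.2, hp⟩⟩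
  · intro f hf
    rw [mem_permsWith] at hf
    exact insertZero_removeZero hf.1.1 (invFun_zero_le hf.1).1
  · rintro ⟨g, p⟩ hx
    obtain ⟨hg, hp⟩ := mem_sigma.1 hx
    rw [mem_permsWith] at hg
    simp only [invFun_insertZero hg.1 (hJ g hg.1 p hp), removeZero_insertZero]
  · intro f hf
    rw [mem_permsWith] at hf
    exact congrArg ψ (insertZero_removeZero hf.1.1 (invFun_zero_le hf.1).1).symm

/-- Summation over a set `A` whose elements are joined in a unique way from a left part of size `x`
and a right part of size `n - x`. -/
lemma sum_eq_sum_antidiagonal {α M : Type*} [AddCommMonoid M] {A : Finset α} {n : ℕ}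
    {B S : ℕ → Finset α} (size : α → ℕ) (l r : α → α) (join : ℕ → ℕ → α → α → α)
    {ψ : α → M} {ψ' : ℕ → ℕ → α → α → M}
    (h1 : ∀ f ∈ A, size f ≤ n ∧ l f ∈ B (size f) ∧ r f ∈ S (n - size f) ∧
      join (size f) (n - size f) (l f) (r f) = f)
    (h2 : ∀ x y a b, x + y = n → a ∈ B x → b ∈ S y → join x y a b ∈ A ∧
      size (join x y a b) = x ∧ l (join x y a b) = a ∧ r (join x y a b) = b ∧
      ψ (join x y a b) = ψ' x y a b) :
    ∑ f ∈ A, ψ f =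
      ∑ p ∈ antidiagonal n, ∑ a ∈ B p.1, ∑ b ∈ S p.2, ψ' p.1 p.2 a b := by
  simp only [← sum_product']
  rw [sum_sigma']
  refine sum_nbij' (fun f => ⟨(size f, n - size f), (l f, r f)⟩)
    (fun x => join x.1.1 x.1.2 x.2.1 x.2.2) ?_ ?_ ?_ ?_ ?_
  · intro f hf
    obtain ⟨h, hl, hr, -⟩ := h1 f hf
    simp only [mem_sigma, HasAntidiagonal.mem_antidiagonal, mem_product]
    exact ⟨by omega, hl, hr⟩
  · rintro ⟨⟨x, y⟩, ⟨a, b⟩⟩ hx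
    simp only [mem_sigma, HasAntidiagonal.mem_antidiagonal, mem_product] at hx
    exact (h2 x y a b hx.1 hx.2.1 hx.2.2).1
  · intro f hf
    exact (h1 f hf).2.2.2
  · rintro ⟨⟨x, y⟩, ⟨a, b⟩⟩ hx
    simp only [mem_sigma, HasAntidiagonal.mem_antidiagonal, mem_product] at hx
    obtain ⟨-, e1, e2, e3, -⟩ := h2 x y a b hx.1 hx.2.1 hx.2.2
    have : n - x = y := by omega
    simp only [e1, e2, e3, this]
  · intro f hf
    obtain ⟨h, hl, hr, hj⟩ := h1 f hf
    have := (h2 _ _ _ _ (by omega) hl hr).2.2.2.2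
    rwa [hj] at this

/-! ### Permutations that avoid `321` -/

/-- The first `r` letters of `f` increase. -/
def InitialIncreasing (f : ℕ → ℕ) (r : ℕ) : Prop := ∀ i j, i < j → j < r → f i < f j

open Classical in
/-- The length of the initial increasing run of the permutation `f` of `{0, …, n - 1}`. -/
noncomputable def initialRun (n : ℕ) (f : ℕ → ℕ) : ℕ := Nat.findGreatest (InitialIncreasing f) n

lemma initialRun_le (n : ℕ) (f : ℕ → ℕ) : initialRun n f ≤ n := by
  classical
  unfold initialRun
  exact Nat.findGreatest_le n

lemma le_initialRun_iff {n r : ℕ} {f : ℕ → ℕ} (hr : r ≤ n) :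
    r ≤ initialRun n f ↔ InitialIncreasing f r := by
  classical
  unfold initialRun
  refine ⟨fun h => ?_, fun h => Nat.le_findGreatest hr h⟩
  exact fun i j hij hj => Nat.findGreatest_spec (P := InitialIncreasing f) (Nat.zero_le n)
    (by intro i j _ h; omega) i j hij (by omega)

lemma initialRun_eq {n l : ℕ} {f : ℕ → ℕ} (hl : l ≤ n) (h : InitialIncreasing f l)
    (h' : l < n → ¬ InitialIncreasing f (l + 1)) : initialRun n f = l := by
  refine le_antisymm ?_ ((le_initialRun_iff hl).2 h)
  by_contra hlt
  have h1 := initialRun_le n f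
  exact h' (by omega) ((le_initialRun_iff (n := n) (by omega)).1 (by omega))

lemma avoids321_insertZero {p : ℕ} {g : ℕ → ℕ} (hg : Injective g) :
    Avoids321 (insertZero p g) ↔ Avoids321 g ∧ InitialIncreasing g p := by
  refine ⟨fun h => ⟨fun i j k hij hjk ⟨h1, h2⟩ => ?_, fun i j hij hj => ?_⟩, ?_⟩
  · refine h (if i < p then i else i + 1) (if j < p then j else j + 1)
      (if k < p then k else k + 1) ?_ ?_ ⟨?_, ?_⟩ <;> grind [insertZero]
  · by_contra hlt
    have : g i ≠ g j := fun e => by have := hg e; omega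
    refine h i j p hij hj ⟨?_, ?_⟩ <;> unfold insertZero <;> grind
  · rintro ⟨h, h'⟩ i j k hij hjk ⟨h1, h2⟩
    have hi : i ≠ p := by rintro rfl; simp [insertZero] at h2
    have hj : j ≠ p := by rintro rfl; simp [insertZero] at h1
    by_cases hk : k = p
    · have := h' i j hij (by omega)
      unfold insertZero at h2
      grind
    · refine h (if i < p then i else i - 1) (if j < p then j else j - 1)
        (if k < p then k else k - 1) ?_ ?_ ⟨?_, ?_⟩ <;> unfold insertZero at h1 h2 <;> grind

lemma initialRun_insertZero {n p : ℕ} {g : ℕ → ℕ} (hp : p ≤ initialRun n g) :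
    initialRun (n + 1) (insertZero p g) = if p = 0 then initialRun n g + 1 else p := by
  have hn := initialRun_le n g
  have hL := (le_initialRun_iff hn).1 le_rfl
  split_ifs with h
  · subst h
    refine initialRun_eq (by omega) (fun i j hij hj => ?_) fun hlt hi => ?_
    · have := hL (i - 1) (j - 1)
      unfold insertZero
      grind
    · have : initialRun n g + 1 ≤ initialRun n g := by
        rw [le_initialRun_iff (by omega)]
        intro i j hij hj
        have := hi (i + 1) (j + 1) (by omega) (by omega)
        simpa [insertZero] using this
      omega
  · refine initialRun_eq (by omega) (fun i j hij hj => ?_) fun hlt hi => ?_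
    · have := hL i j
      unfold insertZero
      grind
    · have := hi (p - 1) p (by omega) (by omega)
      simp [insertZero] at this

/-- Before and after a fixed point `i`, a permutation that avoids `321` permutes the smaller and the
larger letters, respectively. -/
lemma lt_iff_of_fixed {n i : ℕ} {f : ℕ → ℕ} (hf : f ∈ permSet n) (hA : Avoids321 f)
    (hi : f i = i) (j : ℕ) : f j < i ↔ j < i := by
  have hne : ∀ j, j ≠ i → f j ≠ i := fun j hj h => hj (hf.1 (h.trans hi.symm))
  have h : ∀ x ∈ range i, f x ∈ range i := by
    by_contra! hcon
    obtain ⟨j, hj, hj'⟩ := hcon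
    simp only [mem_range] at hj hj'
    refine hj' (mem_range.1 (mapsTo_of_exists_preimage (s := range i) (fun v hv => ?_) j
      (mem_range.2 hj)))
    rw [mem_range] at hv
    obtain ⟨k, hk⟩ := surjective_of_mem_permSet hf v
    have h1 := hne j (by omega)
    rcases lt_trichotomy k i with hki | hki | hki
    · exact ⟨k, mem_range.2 hki, hk⟩
    · subst hki; omega
    · exact (hA j i k hj hki ⟨by omega, by omega⟩).elim
  refine ⟨fun hj => ?_, fun hj => mem_range.1 (h j (mem_range.2 hj))⟩
  obtain ⟨x, hx, hx'⟩ := exists_preimage hf.1 h (f j) (mem_range.2 hj)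
  rw [← hf.1 hx']
  exact mem_range.1 hx

/-- The direct sum of `a`, a fixed point at position `i`, and `b`. -/
def directSum (i : ℕ) (a b : ℕ → ℕ) : ℕ → ℕ :=
  fun t => if t < i then a t else if t = i then i else b (t - (i + 1)) + (i + 1)

/-- The least fixed point of `f`. -/
noncomputable def firstFixed (f : ℕ → ℕ) : ℕ := sInf {t | f t = t}

lemma firstFixed_eq {f : ℕ → ℕ} {i : ℕ} (h : f i = i) (h' : ∀ j < i, f j ≠ j) :
    firstFixed f = i := by
  refine le_antisymm (Nat.sInf_le h) ?_
  by_contra hlt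
  exact h' (firstFixed f) (by omega) (Nat.sInf_mem (s := {t | f t = t}) ⟨i, h⟩)

/-- The part of `f` before position `i`. -/
def beforePart (i : ℕ) (f : ℕ → ℕ) : ℕ → ℕ := fun t => if t < i then f t else t

/-- The part of `f` after position `i`, where all letters are larger than `i`. -/
def afterPart (i : ℕ) (f : ℕ → ℕ) : ℕ → ℕ := fun t => f (t + (i + 1)) - (i + 1)

/-- A nonempty derangement is not increasing. -/
lemma not_initialIncreasing {n : ℕ} {f : ℕ → ℕ} (hf : f ∈ permSet n) (hn : n ≠ 0)
    (hd : ∀ i < n, f i ≠ i) : ¬ InitialIncreasing f n := by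
  intro h
  obtain ⟨k, hk⟩ := surjective_of_mem_permSet hf 0
  have hkn : k < n := by
    by_contra hkn
    have := hf.2 k (by omega)
    omega
  rcases Nat.eq_zero_or_pos k with rfl | hpos
  · exact hd 0 (by omega) hk
  · have := h 0 k hpos hkn
    omega

/-- A permutation that avoids `321` and has a fixed point is the direct sum of a derangement, the
first fixed point, and a permutation. -/
lemma sum_avoids321_fixed (n : ℕ) {M : Type*} [AddCommMonoid M] (φ : ℕ → M) :
    ∑ f ∈ permsWith Avoids321 (n + 1), φ (initialRun (n + 1) f) =
      ∑ f ∈ derangementsWith Avoids321 (n + 1), φ (initialRun (n + 1) f) +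
      ∑ p ∈ antidiagonal n, ∑ a ∈ derangementsWith Avoids321 p.1, ∑ b ∈ permsWith Avoids321 p.2,
        φ (if p.1 = 0 then initialRun p.2 b + 1 else initialRun p.1 a) := by
  classical
  rw [← sum_filter_add_sum_filter_not (permsWith Avoids321 (n + 1))
    (fun f : ℕ → ℕ => ∀ i < n + 1, f i ≠ i) (fun f => φ (initialRun (n + 1) f))]
  refine congrArg₂ _ ?_ ?_
  · refine sum_congr ?_ fun _ _ => rfl
    ext f
    simp [mem_permsWith, mem_derangementsWith, and_assoc]
  refine sum_eq_sum_antidiagonal firstFixed (fun f => beforePart (firstFixed f) f)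
    (fun f => afterPart (firstFixed f) f) (fun i _ a b => directSum i a b)
    (ψ' := fun i j a b => φ (if i = 0 then initialRun j b + 1 else initialRun i a)) ?_ ?_
  · intro f hf
    simp only [mem_filter, mem_permsWith, not_forall, not_not] at hf
    obtain ⟨⟨hf, hA⟩, i, hi, hfi⟩ := hf
    have hfix : f (firstFixed f) = firstFixed f := Nat.sInf_mem (s := {t | f t = t}) ⟨i, hfi⟩
    have hle : firstFixed f ≤ i := Nat.sInf_le hfi
    have hmin : ∀ j < firstFixed f, f j ≠ j := fun j hj h => by
      have : firstFixed f ≤ j := Nat.sInf_le h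
      omega
    generalize firstFixed f = m at *
    have hlt := lt_iff_of_fixed hf hA hfix
    have hgt : ∀ t, m < t → m < f t := fun t ht => by
      have h1 := hlt t
      have h2 : f t ≠ m := fun h => by have := hf.1 (h.trans hfix.symm); omega
      omega
    have hinj : ∀ a b, f a = f b → a = b := fun a b h => hf.1 h
    refine ⟨by omega, mem_derangementsWith.2 ⟨⟨fun s t h => ?_, fun t ht => ?_⟩,
      fun a b c hab hbc ⟨h1, h2⟩ => ?_, fun t ht => ?_⟩, mem_permsWith.2 ⟨⟨fun s t h => ?_,
      fun t ht => ?_⟩, fun a b c hab hbc ⟨h1, h2⟩ => ?_⟩, ?_⟩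
    · have h1 := hinj s t
      have h2 := hlt s
      have h3 := hlt t
      unfold beforePart at h
      split_ifs at h <;> omega
    · unfold beforePart
      rw [if_neg (by omega)]
    · have h3 := hA a b c hab hbc
      have h4 := hlt a
      have h5 := hlt b
      unfold beforePart at h1 h2
      split_ifs at h1 h2 <;> omega
    · unfold beforePart
      rw [if_pos ht]
      exact hmin t ht
    · have h1 := hinj (s + (m + 1)) (t + (m + 1))
      have h2 := hgt (s + (m + 1)) (by omega)
      have h3 := hgt (t + (m + 1)) (by omega)
      unfold afterPart at h
      omega
    · have := hf.2 (t + (m + 1)) (by omega)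
      unfold afterPart
      omega
    · have h3 := hA (a + (m + 1)) (b + (m + 1)) (c + (m + 1))
      unfold afterPart at h1 h2
      omega
    · funext t
      have := hgt t
      unfold directSum beforePart afterPart
      split_ifs with h1 h2
      · rfl
      · rw [h2, hfix]
      · rw [show t - (m + 1) + (m + 1) = t by omega]
        omega
  · rintro m j a b hmj ha hb
    obtain ⟨ha, hAa, hda⟩ := mem_derangementsWith.1 ha
    obtain ⟨hb, hAb⟩ := mem_permsWith.1 hb
    have hlt : ∀ t, t < m → a t < m := fun t => lt_of_mem_permSet ha
    have hinja : ∀ s t, a s = a t → s = t := fun s t h => ha.1 h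
    have hinjb : ∀ s t, b s = b t → s = t := fun s t h => hb.1 h
    have hfirst : firstFixed (directSum m a b) = m := firstFixed_eq (by simp [directSum])
      fun t ht => by simp only [directSum, if_pos ht]; exact hda t ht
    refine ⟨?_, hfirst, ?_, ?_, ?_⟩
    · simp only [mem_filter, mem_permsWith, not_forall, not_not]
      refine ⟨⟨⟨fun s t h => ?_, fun t ht => ?_⟩, fun x y z hxy hyz ⟨h1, h2⟩ => ?_⟩, m, by omega,
        by simp [directSum]⟩
      · have h1 := hlt s
        have h2 := hlt t
        have h3 := hinja s t
        have h4 := hinjb (s - (m + 1)) (t - (m + 1))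
        unfold directSum at h
        split_ifs at h <;> omega
      · have := hb.2 (t - (m + 1)) (by omega)
        unfold directSum
        split_ifs <;> omega
      · have h3 := hAa x y z hxy hyz
        have h4 := hAb (x - (m + 1)) (y - (m + 1)) (z - (m + 1))
        have h5 := hlt x
        have h6 := hlt y
        unfold directSum at h1 h2
        split_ifs at h1 h2 <;> omega
    · rw [hfirst]
      funext t
      unfold beforePart directSum
      split_ifs with h
      · rfl
      · exact (ha.2 t (by omega)).symm
    · rw [hfirst]
      funext t
      unfold afterPart directSum
      rw [if_neg (by omega), if_neg (by omega)]
      simp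
    · congr 1
      split_ifs with h
      · subst h
        have hn := initialRun_le j b
        have hL := (le_initialRun_iff hn).1 le_rfl
        refine initialRun_eq (by omega) (fun s t hst ht => ?_) fun hlt hi => ?_
        · have := hL (s - 1) (t - 1)
          unfold directSum
          grind
        · have : initialRun j b + 1 ≤ initialRun j b := by
            rw [le_initialRun_iff (by omega)]
            intro s t hst ht
            have := hi (s + 1) (t + 1) (by omega) (by omega)
            simpa [directSum] using this
          omega
      · have hn := initialRun_le m a
        have hL := (le_initialRun_iff hn).1 le_rfl
        have hlt' : initialRun m a < m := by
          by_contra hge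
          exact not_initialIncreasing ha h hda
            (by rwa [show initialRun m a = m by omega] at hL)
        refine initialRun_eq (by omega) (fun s t hst ht => ?_) fun _ hi => ?_
        · have := hL s t hst ht
          unfold directSum
          rwa [if_pos (by omega), if_pos (by omega)]
        · have : initialRun m a + 1 ≤ initialRun m a := by
            rw [le_initialRun_iff (by omega)]
            intro s t hst ht
            have := hi s t hst ht
            unfold directSum at this
            rwa [if_pos (by omega), if_pos (by omega)] at this
          omega

/-- The permutations that avoid `321`, with the initial increasing run as statistic. -/
theorem runDecomposition_avoids321 :
    RunDecomposition (permsWith Avoids321) (derangementsWith Avoids321) initialRun where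
  zero := by
    have h : Avoids321 id := fun i j k hij hjk ⟨h1, h2⟩ => by simp only [id] at h1 h2; omega
    exact ⟨id, permsWith_zero h, derangementsWith_zero h, Nat.le_zero.1 (initialRun_le 0 _)⟩
  sum_succ n φ := by
    rw [sum_permsWith_succ (J := fun g => range (initialRun n g + 1))]
    · refine sum_congr rfl fun g _ => ?_
      rw [sum_range_succ', sum_range_succ]
      refine congrArg₂ _ (sum_congr rfl fun p hp => ?_) ?_
      · rw [mem_range] at hp
        rw [initialRun_insertZero (by omega), if_neg p.succ_ne_zero]
      · rw [initialRun_insertZero (Nat.zero_le _), if_pos rfl]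
    · intro g _ p hp
      have := initialRun_le n g
      have := mem_range.1 hp
      omega
    · intro g hg p hp
      rw [avoids321_insertZero hg.1, mem_range, Nat.lt_succ_iff, le_initialRun_iff hp]
  sum_eq_derangements n φ := sum_avoids321_fixed n φ

end Permutations

/-! ### Permutations that avoid `132` -/

section Avoiding132

open Finset Function

/-- The last `r` letters of the permutation `f` of `{0, …, n - 1}` increase. -/
def FinalIncreasing (n : ℕ) (f : ℕ → ℕ) (r : ℕ) : Prop :=
  ∀ i j, n ≤ i + r → i < j → j < n → f i < f j

open Classical in
/-- The length of the final increasing run of the permutation `f` of `{0, …, n - 1}`. -/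
noncomputable def finalRun (n : ℕ) (f : ℕ → ℕ) : ℕ := Nat.findGreatest (FinalIncreasing n f) n

lemma finalRun_le (n : ℕ) (f : ℕ → ℕ) : finalRun n f ≤ n := by
  classical
  unfold finalRun
  exact Nat.findGreatest_le n

lemma le_finalRun_iff {n r : ℕ} {f : ℕ → ℕ} (hr : r ≤ n) :
    r ≤ finalRun n f ↔ FinalIncreasing n f r := by
  classical
  unfold finalRun
  refine ⟨fun h => ?_, fun h => Nat.le_findGreatest hr h⟩
  exact fun i j hi hij hj => Nat.findGreatest_spec (P := FinalIncreasing n f) (Nat.zero_le n)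
    (by intro i j _ _ h; omega) i j (by omega) hij hj

lemma finalRun_eq {n l : ℕ} {f : ℕ → ℕ} (hl : l ≤ n) (h : FinalIncreasing n f l)
    (h' : l < n → ¬ FinalIncreasing n f (l + 1)) : finalRun n f = l := by
  refine le_antisymm ?_ ((le_finalRun_iff hl).2 h)
  by_contra hlt
  have h1 := finalRun_le n f
  exact h' (by omega) ((le_finalRun_iff (n := n) (by omega)).1 (by omega))

lemma avoids132_insertZero {n p : ℕ} {g : ℕ → ℕ} (hg : g ∈ permSet n) (hp : p ≤ n) :
    Avoids132 (insertZero p g) ↔ Avoids132 g ∧ FinalIncreasing n g (n - p) := by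
  refine ⟨fun h => ⟨fun i j k hij hjk ⟨h1, h2⟩ => ?_, fun i j hi hij hj => ?_⟩, ?_⟩
  · refine h (if i < p then i else i + 1) (if j < p then j else j + 1)
      (if k < p then k else k + 1) ?_ ?_ ⟨?_, ?_⟩ <;> grind [insertZero]
  · by_contra hlt
    have : g i ≠ g j := fun e => by have := hg.1 e; omega
    refine h p (i + 1) (j + 1) (by omega) (by omega) ⟨?_, ?_⟩ <;> grind [insertZero]
  · rintro ⟨h, h'⟩ i j k hij hjk ⟨h1, h2⟩
    have hk : k ≠ p := by rintro rfl; simp [insertZero] at h1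
    have hj : j ≠ p := by rintro rfl; simp [insertZero] at h2
    by_cases hi : i = p
    · have h3 := h' (j - 1) (k - 1) (by omega) (by omega)
      have h4 := hg.2 (k - 1)
      have h5 := hg.2 (j - 1)
      have h6 := @lt_of_mem_permSet n g hg (j - 1)
      unfold insertZero at h2
      grind
    · refine h (if i < p then i else i - 1) (if j < p then j else j - 1)
        (if k < p then k else k - 1) ?_ ?_ ⟨?_, ?_⟩ <;> unfold insertZero at h1 h2 <;> grind

lemma finalRun_insertZero {n l : ℕ} {g : ℕ → ℕ} (hl : l ≤ finalRun n g) :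
    finalRun (n + 1) (insertZero (n - l) g) = l + 1 := by
  have hn := finalRun_le n g
  have hL := (le_finalRun_iff (hl.trans hn)).1 hl
  refine finalRun_eq (by omega) (fun i j hi hij hj => ?_) fun hlt hi => ?_
  · have := hL (i - 1) (j - 1)
    unfold insertZero
    grind
  · have := hi (n - l - 1) (n - l) (by omega) (by omega) (by omega)
    simp [insertZero] at this

/-- The order isomorphism from `ℕ` to the complement of the interval `[p, p + k]`. -/
def stretch (p k t : ℕ) : ℕ := if t < p then t else t + (k + 1)

/-- The inverse of `stretch p k` outside of the interval `[p, p + k]`. -/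
def squeeze (p k t : ℕ) : ℕ := if t < p then t else t - (k + 1)

lemma squeeze_stretch (p k t : ℕ) : squeeze p k (stretch p k t) = t := by
  unfold squeeze stretch
  split_ifs <;> omega

lemma stretch_squeeze {p k t : ℕ} (h : t < p ∨ p + k < t) : stretch p k (squeeze p k t) = t := by
  unfold squeeze stretch
  split_ifs <;> omega

lemma stretch_lt_stretch {p k s t : ℕ} : stretch p k s < stretch p k t ↔ s < t := by
  unfold stretch
  split_ifs <;> omega

lemma stretch_injective (p k : ℕ) : Injective (stretch p k) :=
  LeftInverse.injective (squeeze_stretch p k)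

lemma stretch_outside (p k t : ℕ) : stretch p k t < p ∨ p + k < stretch p k t := by
  unfold stretch
  split_ifs <;> omega

lemma squeeze_lt_squeeze {p k s t : ℕ} (hs : s < p ∨ p + k < s) (ht : t < p ∨ p + k < t) :
    squeeze p k s < squeeze p k t ↔ s < t := by
  rw [← stretch_lt_stretch (p := p) (k := k), stretch_squeeze hs, stretch_squeeze ht]

/-- Cut `a` at position `p` and at height `p`, and put there a block that consists of `b`, a
permutation of `k` letters, followed by a fixed point. -/
def nest (p k : ℕ) (a b : ℕ → ℕ) : ℕ → ℕ := fun t =>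
  if t < p ∨ p + k < t then stretch p k (a (squeeze p k t))
  else if t < p + k then b (t - p) + p else t

/-- What remains of `f` when positions and letters in `[p, p + k]` are removed. -/
def outerPart (p k : ℕ) (f : ℕ → ℕ) : ℕ → ℕ := fun t => squeeze p k (f (stretch p k t))

/-- The restriction of `f` to `[p, p + k)`, as a permutation of `k` letters. -/
def blockPart (p k : ℕ) (f : ℕ → ℕ) : ℕ → ℕ := fun t => if t < k then f (t + p) - p else t

/-- The least `q` such that some letter among the first `q + 1` is at most `q`; the larger letters
in later positions then form an increasing sequence if the pattern `132` is avoided. -/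
noncomputable def cutPoint (a : ℕ → ℕ) : ℕ := sInf {q | ∃ t ≤ q, a t ≤ q}

lemma cutPoint_eq {a : ℕ → ℕ} {p : ℕ} (h : ∃ t ≤ p, a t ≤ p) (h' : ∀ t < p, p ≤ a t) :
    cutPoint a = p := by
  refine le_antisymm (Nat.sInf_le h) ?_
  by_contra hlt
  obtain ⟨t, ht, hat⟩ : ∃ t ≤ cutPoint a, a t ≤ cutPoint a :=
    Nat.sInf_mem (s := {q | ∃ t ≤ q, a t ≤ q}) ⟨p, h⟩
  have := h' t (by omega)
  omega

lemma exists_le_cutPoint {m : ℕ} {a : ℕ → ℕ} (ha : a ∈ permSet m) :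
    ∃ t ≤ cutPoint a, a t ≤ cutPoint a :=
  Nat.sInf_mem (s := {q | ∃ t ≤ q, a t ≤ q}) ⟨m, m, le_rfl, (ha.2 m le_rfl).le⟩

lemma cutPoint_le {m : ℕ} {a : ℕ → ℕ} (ha : a ∈ permSet m) : cutPoint a ≤ m :=
  Nat.sInf_le (s := {q | ∃ t ≤ q, a t ≤ q}) ⟨m, le_rfl, (ha.2 m le_rfl).le⟩

lemma cutPoint_lt {m : ℕ} {a : ℕ → ℕ} (ha : a ∈ permSet m) (hm : m ≠ 0) : cutPoint a < m := by
  have h := lt_of_mem_permSet ha (i := 0) (by omega)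
  have : cutPoint a ≤ m - 1 :=
    Nat.sInf_le (s := {q | ∃ t ≤ q, a t ≤ q}) ⟨0, by omega, by omega⟩
  omega

lemma le_of_lt_cutPoint {a : ℕ → ℕ} {t : ℕ} (ht : t < cutPoint a) : cutPoint a ≤ a t := by
  by_contra hlt
  have : cutPoint a ≤ cutPoint a - 1 :=
    Nat.sInf_le (s := {q | ∃ t ≤ q, a t ≤ q}) ⟨t, by omega, by omega⟩
  omega

lemma cutPoint_pos {m : ℕ} {a : ℕ → ℕ} (ha : a ∈ permSet m) (h0 : a 0 ≠ 0) : 0 < cutPoint a := by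
  obtain ⟨t, ht, hat⟩ := exists_le_cutPoint ha
  by_contra h
  have : t = 0 := by omega
  subst this
  omega

lemma increasing_after_cutPoint {m : ℕ} {a : ℕ → ℕ} (ha : a ∈ permSet m) (hA : Avoids132 a)
    {s t : ℕ} (hs : cutPoint a ≤ s) (hst : s < t) (has : cutPoint a ≤ a s)
    (hat : cutPoint a ≤ a t) : a s < a t := by
  obtain ⟨u, hu, hau⟩ := exists_le_cutPoint ha
  by_contra hlt
  have h1 : a t ≠ a s := fun h => by have := ha.1 h; omega
  have h2 : a t = a u → t = u := fun h => ha.1 h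
  have h3 : a s = a u → s = u := fun h => ha.1 h
  have h4 : u ≠ s := by rintro rfl; omega
  have h5 : u ≠ t := by rintro rfl; omega
  exact hA u s t (by omega) hst ⟨by omega, by omega⟩

/-- In a permutation that avoids `132`, let `i` be a fixed point and `p` the position of the first
letter that is at most `i`. Then the interval `[p, i]` is mapped into itself. -/
lemma block_of_fixed {n i p : ℕ} {f : ℕ → ℕ} (hf : f ∈ permSet n) (hA : Avoids132 f)
    (hi : f i = i) (hp : f p ≤ i) (hlt : ∀ t < p, i < f t) (t : ℕ) :
    (p ≤ t ∧ t ≤ i) ↔ (p ≤ f t ∧ f t ≤ i) := by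
  have hne : ∀ j, j ≠ i → f j ≠ i := fun j hj h => hj (hf.1 (h.trans hi.symm))
  have hpi : p ≤ i := by
    by_contra h
    have := hlt i (by omega)
    omega
  have hle : ∀ t, p ≤ t → t ≤ i → f t ≤ i := by
    intro t h1 h2
    by_contra h3
    have h4 : t ≠ p := by rintro rfl; omega
    have h5 : t ≠ i := by rintro rfl; omega
    have h6 := hne p (by omega)
    exact hA p t i (by omega) (by omega) ⟨by omega, by omega⟩
  have hge : ∀ t, p ≤ t → t ≤ i → p ≤ f t := by
    intro t h1 h2
    rcases eq_or_ne t i with rfl | h3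
    · omega
    -- The letters in `[f t, i)` are all at positions in `[p, i)`: later ones would be the last
    -- letter of a subsequence with the order of `132` that starts at `t` and `i`.
    have hsub : Ico (f t) i ⊆ (Ico p i).image f := by
      intro v hv
      rw [mem_Ico] at hv
      obtain ⟨s, rfl⟩ := surjective_of_mem_permSet hf v
      refine mem_image_of_mem f (mem_Ico.2 ⟨?_, ?_⟩)
      · by_contra hs
        have := hlt s (by omega)
        omega
      · by_contra hs
        have h4 : s ≠ i := by rintro rfl; omega
        have h5 : f s = f t → s = t := fun h => hf.1 h
        exact hA t i s (by omega) (by omega) ⟨by omega, by omega⟩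
    have h4 := (card_le_card hsub).trans card_image_le
    rw [Nat.card_Ico, Nat.card_Ico] at h4
    have h5 := hle t h1 h2
    have h6 := hne t h3
    omega
  refine ⟨fun h => ⟨hge t h.1 h.2, hle t h.1 h.2⟩, fun h => ?_⟩
  obtain ⟨x, hx, hx'⟩ := exists_preimage (s := Icc p i) hf.1
    (fun x hx => mem_Icc.2 ⟨hge x (mem_Icc.1 hx).1 (mem_Icc.1 hx).2,
      hle x (mem_Icc.1 hx).1 (mem_Icc.1 hx).2⟩) (f t) (mem_Icc.2 h)
  rw [← hf.1 hx']
  exact mem_Icc.1 hx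

/-- The fixed point `p + k` is the last one of the permutation `f` of `{0, …, n}`, which avoids
`132`, and `p` is the position of the first letter that is at most `p + k`. -/
structure IsLastBlock (n p k : ℕ) (f : ℕ → ℕ) : Prop where
  mem : f ∈ permSet (n + 1)
  avoids : Avoids132 f
  fixed : f (p + k) = p + k
  le : p + k ≤ n
  first : f p ≤ p + k
  before : ∀ t < p, p + k < f t
  last : ∀ j, p + k < j → j ≤ n → f j ≠ j

namespace IsLastBlock

variable {n p k : ℕ} {f : ℕ → ℕ}

lemma mem_block_iff (h : IsLastBlock n p k f) (t : ℕ) :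
    (p ≤ t ∧ t ≤ p + k) ↔ (p ≤ f t ∧ f t ≤ p + k) :=
  block_of_fixed h.mem h.avoids h.fixed h.first h.before t

lemma stretch_outerPart (h : IsLastBlock n p k f) (t : ℕ) :
    stretch p k (outerPart p k f t) = f (stretch p k t) := by
  refine stretch_squeeze ?_
  have h1 := h.mem_block_iff (stretch p k t)
  have h2 := stretch_outside p k t
  omega

lemma outerPart_mem (h : IsLastBlock n p k f) :
    outerPart p k f ∈ derangementsWith Avoids132 (n - k) := by
  have hle := h.le
  refine mem_derangementsWith.2 ⟨⟨fun s t hst => ?_, fun t ht => ?_⟩,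
    fun s t u hst htu ⟨h1, h2⟩ => ?_, fun t ht he => ?_⟩
  · have := congrArg (stretch p k) hst
    rw [h.stretch_outerPart, h.stretch_outerPart] at this
    exact stretch_injective p k (h.mem.1 this)
  · have h1 : n + 1 ≤ stretch p k t := by
      unfold stretch
      split_ifs <;> omega
    refine stretch_injective p k ?_
    rw [h.stretch_outerPart, h.mem.2 _ h1]
  · rw [← stretch_lt_stretch (p := p) (k := k), h.stretch_outerPart, h.stretch_outerPart] at h1 h2
    exact h.avoids _ _ _ (stretch_lt_stretch.2 hst) (stretch_lt_stretch.2 htu) ⟨h1, h2⟩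
  · have h1 := h.stretch_outerPart t
    rw [he] at h1
    have h2 : stretch p k t ≤ n := by
      unfold stretch
      split_ifs <;> omega
    rcases stretch_outside p k t with h3 | h3
    · have := h.before _ h3
      omega
    · exact h.last _ h3 h2 h1.symm

/-- Otherwise the fixed point `p + k` of `f` would start a subsequence with the order of `132`. -/
lemma cutPoint_outerPart (h : IsLastBlock n p k f) : cutPoint (outerPart p k f) = p := by
  have hm := (mem_derangementsWith.1 h.outerPart_mem).1
  refine cutPoint_eq ?_ fun t ht => ?_
  · by_contra! hcon
    obtain ⟨s, hs⟩ := surjective_of_mem_permSet hm p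
    have hsp : p < s := by
      by_contra hle
      have := hcon s (by omega)
      omega
    have hp := hcon p le_rfl
    have h1 := h.stretch_outerPart s
    rw [hs] at h1
    refine h.avoids (p + k) (stretch p k p) (stretch p k s) ?_ (stretch_lt_stretch.2 hsp) ⟨?_, ?_⟩
    · simp [stretch]
    · rw [h.fixed, ← h1]
      simp [stretch]
    · rw [← h1, ← h.stretch_outerPart]
      exact stretch_lt_stretch.2 hp
  · have h1 := h.before t ht
    unfold outerPart squeeze stretch
    split_ifs <;> omega

lemma blockPart_mem (h : IsLastBlock n p k f) : blockPart p k f ∈ permsWith Avoids132 k := by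
  have h1 : ∀ t < k, p ≤ f (t + p) := fun t ht => ((h.mem_block_iff (t + p)).1 (by omega)).1
  have h2 : ∀ t < k, f (t + p) < p + k := fun t ht => by
    have h3 := ((h.mem_block_iff (t + p)).1 (by omega)).2
    have h4 : f (t + p) ≠ p + k := fun he => by
      have := h.mem.1 (he.trans h.fixed.symm)
      omega
    omega
  refine mem_permsWith.2 ⟨⟨fun s t hst => ?_, fun t ht => ?_⟩, fun s t u hst htu ⟨h3, h4⟩ => ?_⟩
  · have h3 := h1 s
    have h4 := h1 t
    have h5 := h2 s
    have h6 := h2 t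
    have h7 : f (s + p) = f (t + p) → s + p = t + p := fun e => h.mem.1 e
    unfold blockPart at hst
    split_ifs at hst <;> omega
  · unfold blockPart
    rw [if_neg (by omega)]
  · have h5 := h1 s
    have h6 := h1 t
    have h7 := h1 u
    have h8 := h2 t
    have h9 := h.avoids (s + p) (t + p) (u + p)
    unfold blockPart at h3 h4
    split_ifs at h3 h4 <;> omega

lemma nest_eq (h : IsLastBlock n p k f) :
    nest p k (outerPart p k f) (blockPart p k f) = f := by
  funext t
  unfold nest
  split_ifs with h1 h2
  · rw [h.stretch_outerPart, stretch_squeeze h1]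
  · have h3 := ((h.mem_block_iff t).1 (by omega)).1
    unfold blockPart
    rw [if_pos (by omega), show t - p + p = t by omega]
    omega
  · have : t = p + k := by omega
    rw [this, h.fixed]

lemma findGreatest_eq (h : IsLastBlock n p k f) :
    Nat.findGreatest (fun i => f i = i) n = p + k :=
  Nat.findGreatest_eq_iff.2 ⟨h.le, fun _ => h.fixed, fun {j} hj hjn => h.last j hj hjn⟩

lemma sInf_eq (h : IsLastBlock n p k f) : sInf {j | f j ≤ p + k} = p := by
  refine le_antisymm (Nat.sInf_le h.first) ?_
  by_contra hlt
  have h1 := h.before _ (not_le.1 hlt)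
  have h2 : f (sInf {j | f j ≤ p + k}) ≤ p + k := Nat.sInf_mem (s := {j | f j ≤ p + k}) ⟨p, h.first⟩
  omega

end IsLastBlock

/-- The last fixed point of a permutation `f` of `{0, …, n}`. -/
def lastFixed (n : ℕ) (f : ℕ → ℕ) : ℕ := Nat.findGreatest (fun i => f i = i) n

/-- The position of the first letter of `f` that is at most the last fixed point. -/
noncomputable def blockStart (n : ℕ) (f : ℕ → ℕ) : ℕ := sInf {j | f j ≤ lastFixed n f}

lemma exists_isLastBlock {n i : ℕ} {f : ℕ → ℕ} (hf : f ∈ permSet (n + 1)) (hA : Avoids132 f)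
    (hin : i ≤ n) (hi : f i = i) :
    IsLastBlock n (blockStart n f) (lastFixed n f - blockStart n f) f := by
  have h1 : f (lastFixed n f) = lastFixed n f :=
    Nat.findGreatest_spec (P := fun i => f i = i) hin hi
  have h2 : lastFixed n f ≤ n := Nat.findGreatest_le n
  have h3 : f (blockStart n f) ≤ lastFixed n f :=
    Nat.sInf_mem (s := {j | f j ≤ lastFixed n f}) ⟨_, h1.le⟩
  have h4 : blockStart n f ≤ lastFixed n f := Nat.sInf_le (s := {j | f j ≤ lastFixed n f}) h1.le
  have h5 : blockStart n f + (lastFixed n f - blockStart n f) = lastFixed n f := by omega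
  refine ⟨hf, hA, by rwa [h5], by rwa [h5], by rwa [h5], fun t ht => ?_, fun j hj hjn => ?_⟩
  · rw [h5]
    by_contra hle
    have : blockStart n f ≤ t := Nat.sInf_le (s := {j | f j ≤ lastFixed n f}) (not_lt.1 hle)
    omega
  · rw [h5] at hj
    exact Nat.findGreatest_is_greatest (P := fun i => f i = i) hj hjn

section Nest

variable {m k : ℕ} {a b : ℕ → ℕ}

lemma nest_stretch (p k : ℕ) (a b : ℕ → ℕ) (t : ℕ) :
    nest p k a b (stretch p k t) = stretch p k (a t) := by
  unfold nest
  rw [if_pos (stretch_outside p k t), squeeze_stretch]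

lemma outerPart_nest (p k : ℕ) (a b : ℕ → ℕ) : outerPart p k (nest p k a b) = a := by
  funext t
  unfold outerPart
  rw [nest_stretch, squeeze_stretch]

lemma nest_block {p t : ℕ} (ht : t < k) : nest p k a b (t + p) = b t + p := by
  unfold nest
  rw [if_neg (by omega), if_pos (by omega), Nat.add_sub_cancel]

lemma nest_fixed (p k : ℕ) (a b : ℕ → ℕ) : nest p k a b (p + k) = p + k := by
  unfold nest
  rw [if_neg (by omega), if_neg (by omega)]

lemma blockPart_nest {p : ℕ} (hb : b ∈ permSet k) : blockPart p k (nest p k a b) = b := by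
  funext t
  unfold blockPart
  split_ifs with h
  · rw [nest_block h, Nat.add_sub_cancel]
  · exact (hb.2 t (by omega)).symm

lemma nest_mem_block_iff {p : ℕ} (hb : b ∈ permSet k) (t : ℕ) :
    (p ≤ nest p k a b t ∧ nest p k a b t ≤ p + k) ↔ (p ≤ t ∧ t ≤ p + k) := by
  by_cases h : t < p ∨ p + k < t
  · rw [← stretch_squeeze h, nest_stretch]
    have h1 := stretch_outside p k (a (squeeze p k t))
    have h2 := stretch_outside p k (squeeze p k t)
    omega
  · have := lt_of_mem_permSet hb (i := t - p)
    unfold nest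
    rw [if_neg h]
    split_ifs <;> omega

lemma nest_mem {p : ℕ} (ha : a ∈ permSet m) (hb : b ∈ permSet k) (hp : p ≤ m) :
    nest p k a b ∈ permSet (m + k + 1) := by
  refine ⟨fun s t hst => ?_, fun t ht => ?_⟩
  · have h1 := nest_mem_block_iff (a := a) (p := p) hb s
    have h2 := nest_mem_block_iff (a := a) (p := p) hb t
    rw [hst] at h1
    by_cases h : s < p ∨ p + k < s
    · have h' : t < p ∨ p + k < t := by omega
      rw [← stretch_squeeze h, ← stretch_squeeze h', nest_stretch, nest_stretch] at hst
      have := ha.1 (stretch_injective p k hst)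
      rw [← stretch_squeeze h, ← stretch_squeeze h', this]
    · have h' : ¬ (t < p ∨ p + k < t) := by omega
      have h3 := lt_of_mem_permSet hb (i := s - p)
      have h4 := lt_of_mem_permSet hb (i := t - p)
      have h5 : b (s - p) = b (t - p) → s - p = t - p := fun e => hb.1 e
      unfold nest at hst
      rw [if_neg h, if_neg h'] at hst
      split_ifs at hst <;> omega
  · have h : t < p ∨ p + k < t := by omega
    rw [← stretch_squeeze h, nest_stretch, ha.2]
    unfold squeeze
    rw [if_neg (by omega)]
    omega

/-- A subsequence with the order of `132` in `nest p k a b`, where `p` is the cut point of `a`, lies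
inside or outside of the block: letters in front of the block are larger than its letters, and after
it the larger letters increase. -/
lemma avoids132_nest (ha : a ∈ permSet m) (hA : Avoids132 a) (hb : b ∈ permSet k)
    (hB : Avoids132 b) : Avoids132 (nest (cutPoint a) k a b) := by
  intro s t u hst htu ⟨h1, h2⟩
  set p := cutPoint a with hp
  have hlarge : ∀ x < p, p + k < nest p k a b x := fun x hx => by
    have := le_of_lt_cutPoint hx
    unfold nest squeeze stretch
    rw [if_pos (by omega), if_pos hx]
    split_ifs <;> omega
  have hs := nest_mem_block_iff (a := a) (p := p) hb s
  have ht := nest_mem_block_iff (a := a) (p := p) hb t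
  have hu := nest_mem_block_iff (a := a) (p := p) hb u
  by_cases hs' : s < p ∨ p + k < s
  · have ht' : t < p ∨ p + k < t := by
      by_contra h
      have := hlarge s
      omega
    have hu' : u < p ∨ p + k < u := by
      by_contra h
      have := hlarge s
      omega
    rw [← stretch_squeeze hs', ← stretch_squeeze hu', nest_stretch, nest_stretch,
      stretch_lt_stretch] at h1
    rw [← stretch_squeeze ht', ← stretch_squeeze hu', nest_stretch, nest_stretch,
      stretch_lt_stretch] at h2
    exact hA _ _ _ ((squeeze_lt_squeeze hs' ht').2 hst) ((squeeze_lt_squeeze ht' hu').2 htu)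
      ⟨h1, h2⟩
  · by_cases hu' : u < p ∨ p + k < u
    · have ht' : t < p ∨ p + k < t := by omega
      have h3 := (squeeze_lt_squeeze ht' hu').2 htu
      rw [← stretch_squeeze hu', nest_stretch] at h1
      rw [← stretch_squeeze ht', ← stretch_squeeze hu', nest_stretch, nest_stretch,
        stretch_lt_stretch] at h2
      have h4 : p ≤ a (squeeze p k u) := by
        unfold stretch at h1
        split_ifs at h1 <;> omega
      have h5 : p ≤ squeeze p k t := by
        unfold squeeze
        split_ifs <;> omega
      have := increasing_after_cutPoint ha hA h5 h3 (by omega) h4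
      omega
    · have ht' : ¬ (t < p ∨ p + k < t) := by omega
      have h3 := hB (s - p) (t - p) (u - p)
      have h4 := lt_of_mem_permSet hb (i := t - p)
      unfold nest at h1 h2
      rw [if_neg hs', if_neg hu'] at h1
      rw [if_neg hu', if_neg ht'] at h2
      split_ifs at h1 h2 <;> omega

/-- Nesting is inverse to cutting out the last block. -/
lemma isLastBlock_nest {n : ℕ} (hn : m + k = n) (ha : a ∈ derangementsWith Avoids132 m)
    (hb : b ∈ permsWith Avoids132 k) :
    IsLastBlock n (cutPoint a) k (nest (cutPoint a) k a b) := by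
  subst hn
  obtain ⟨ha, hA, hd⟩ := mem_derangementsWith.1 ha
  obtain ⟨hb, hB⟩ := mem_permsWith.1 hb
  have hp := cutPoint_le ha
  refine ⟨nest_mem ha hb hp, avoids132_nest ha hA hb hB, nest_fixed _ _ _ _, by omega, ?_,
    fun t ht => ?_, fun j hj hjn he => ?_⟩
  · exact ((nest_mem_block_iff hb _).2 (by omega)).2
  · have := le_of_lt_cutPoint ht
    unfold nest squeeze stretch
    rw [if_pos (by omega), if_pos ht]
    split_ifs <;> omega
  · have h : j < cutPoint a ∨ cutPoint a + k < j := by omega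
    rw [← stretch_squeeze h, nest_stretch] at he
    refine hd _ ?_ (stretch_injective _ _ he)
    unfold squeeze
    rw [if_neg (by omega)]
    omega

/-- The smallest letter of a nonempty derangement `a` comes after the cut point, so that the final
increasing run does not reach the block. -/
lemma finalIncreasing_nest_iff (ha : a ∈ permSet m) (hm : m ≠ 0) (hd : ∀ i < m, a i ≠ i) (r : ℕ) :
    FinalIncreasing (m + k + 1) (nest (cutPoint a) k a b) r ↔ FinalIncreasing m a r := by
  have hpm := cutPoint_lt ha hm
  have hp0 := cutPoint_pos ha (hd 0 (by omega))
  have hlarge : ∀ t < cutPoint a, cutPoint a ≤ a t := fun t => le_of_lt_cutPoint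
  generalize cutPoint a = p at *
  obtain ⟨z, hz⟩ := surjective_of_mem_permSet ha 0
  have hzp : p ≤ z := by
    by_contra h
    have := hlarge z (by omega)
    omega
  have hzm : z < m := by
    by_contra h
    have := ha.2 z (by omega)
    omega
  refine ⟨fun h => ?_, fun h => ?_⟩
  · have hr : p + r ≤ m := by
      by_contra hr
      have h1 := h (p + k) (stretch p k z) (by omega) (by unfold stretch; split_ifs <;> omega)
        (by unfold stretch; split_ifs <;> omega)
      rw [nest_fixed, nest_stretch, hz] at h1
      unfold stretch at h1
      split_ifs at h1
      omega
    intro s t hs hst ht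
    have h1 := h (stretch p k s) (stretch p k t) (by unfold stretch; split_ifs <;> omega)
      (stretch_lt_stretch.2 hst) (by unfold stretch; split_ifs <;> omega)
    rwa [nest_stretch, nest_stretch, stretch_lt_stretch] at h1
  · have hr : p + r ≤ m := by
      by_contra hr
      have := h (p - 1) z (by omega) (by omega) hzm
      omega
    intro s t hs hst ht
    have hs' : s < p ∨ p + k < s := by omega
    have ht' : t < p ∨ p + k < t := by omega
    rw [← stretch_squeeze hs', ← stretch_squeeze ht', nest_stretch, nest_stretch,
      stretch_lt_stretch]
    refine h _ _ ?_ ((squeeze_lt_squeeze hs' ht').2 hst) ?_ <;> unfold squeeze <;>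
      split_ifs <;> omega

lemma finalRun_nest (ha : a ∈ permSet m) (hb : b ∈ permSet k) (hd : ∀ i < m, a i ≠ i) :
    finalRun (m + k + 1) (nest (cutPoint a) k a b) =
      if m = 0 then finalRun k b + 1 else finalRun m a := by
  split_ifs with hm
  · subst hm
    have hp : cutPoint a = 0 := Nat.le_zero.1 (cutPoint_le ha)
    have hn := finalRun_le k b
    have hL := (le_finalRun_iff hn).1 le_rfl
    rw [hp]
    have hblock : ∀ t < k, nest 0 k a b t = b t := fun t ht => nest_block (p := 0) ht
    have hfix : nest 0 k a b k = k := by simpa using nest_fixed 0 k a b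
    refine finalRun_eq (by omega) (fun s t hs hst ht => ?_) fun hlt hi => ?_
    · have h1 := lt_of_mem_permSet hb (i := s)
      rw [hblock s (by omega)]
      rcases Nat.lt_or_ge t k with h | h
      · rw [hblock t h]
        exact hL s t (by omega) hst h
      · rw [show t = k by omega, hfix]
        omega
    · have : finalRun k b + 1 ≤ finalRun k b := by
        rw [le_finalRun_iff (by omega)]
        intro s t hs hst ht
        have := hi s t (by omega) hst (by omega)
        rwa [hblock s (by omega), hblock t ht] at this
      omega
  · have hn := finalRun_le m a
    refine finalRun_eq (by omega) ?_ fun _ hi => ?_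
    · rw [finalIncreasing_nest_iff ha hm hd]
      exact (le_finalRun_iff hn).1 le_rfl
    · rw [finalIncreasing_nest_iff ha hm hd] at hi
      have hlt : finalRun m a < m := by
        by_contra hge
        refine not_initialIncreasing ha hm hd fun i j hij hj => hi i j (by omega) hij hj
      have := (le_finalRun_iff (by omega)).2 hi
      omega

end Nest

/-- A permutation that avoids `132` and has a fixed point arises by nesting a block, whose last
letter is the last fixed point, into a derangement. -/
lemma sum_avoids132_fixed (n : ℕ) {M : Type*} [AddCommMonoid M] (φ : ℕ → M) :
    ∑ f ∈ permsWith Avoids132 (n + 1), φ (finalRun (n + 1) f) =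
      ∑ f ∈ derangementsWith Avoids132 (n + 1), φ (finalRun (n + 1) f) +
      ∑ p ∈ antidiagonal n, ∑ a ∈ derangementsWith Avoids132 p.1, ∑ b ∈ permsWith Avoids132 p.2,
        φ (if p.1 = 0 then finalRun p.2 b + 1 else finalRun p.1 a) := by
  classical
  rw [← sum_filter_add_sum_filter_not (permsWith Avoids132 (n + 1))
    (fun f : ℕ → ℕ => ∀ i < n + 1, f i ≠ i) (fun f => φ (finalRun (n + 1) f))]
  refine congrArg₂ _ ?_ ?_
  · refine sum_congr ?_ fun _ _ => rfl
    ext f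
    simp [mem_permsWith, mem_derangementsWith, and_assoc]
  refine sum_eq_sum_antidiagonal (fun f => n - (lastFixed n f - blockStart n f))
    (fun f => outerPart (blockStart n f) (lastFixed n f - blockStart n f) f)
    (fun f => blockPart (blockStart n f) (lastFixed n f - blockStart n f) f)
    (fun _ k a b => nest (cutPoint a) k a b)
    (ψ' := fun i j a b => φ (if i = 0 then finalRun j b + 1 else finalRun i a)) ?_ ?_
  · intro f hf
    simp only [mem_filter, mem_permsWith, not_forall, not_not] at hf
    obtain ⟨⟨hf, hA⟩, i, hi, hfi⟩ := hf
    have h := exists_isLastBlock hf hA (Nat.lt_succ_iff.1 hi) hfi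
    generalize lastFixed n f - blockStart n f = k at *
    generalize blockStart n f = p at *
    have hle := h.le
    have hk : n - (n - k) = k := by omega
    refine ⟨Nat.sub_le _ _, h.outerPart_mem, ?_, ?_⟩
    · rw [hk]
      exact h.blockPart_mem
    · rw [hk, h.cutPoint_outerPart, h.nest_eq]
  · rintro m k a b hmk ha hb
    have h := isLastBlock_nest hmk ha hb
    obtain ⟨ha, hA, hd⟩ := mem_derangementsWith.1 ha
    obtain ⟨hb, hB⟩ := mem_permsWith.1 hb
    have h1 : lastFixed n (nest (cutPoint a) k a b) = cutPoint a + k := h.findGreatest_eq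
    have h2 : blockStart n (nest (cutPoint a) k a b) = cutPoint a := by
      unfold blockStart
      rw [h1, h.sInf_eq]
    refine ⟨?_, ?_, ?_, ?_, ?_⟩
    · simp only [mem_filter, mem_permsWith, not_forall, not_not]
      have := h.le
      exact ⟨⟨h.mem, h.avoids⟩, cutPoint a + k, by omega, h.fixed⟩
    · rw [h1, h2]
      omega
    · rw [h1, h2, Nat.add_sub_cancel_left, outerPart_nest]
    · rw [h1, h2, Nat.add_sub_cancel_left, blockPart_nest hb]
    · rw [← hmk, finalRun_nest ha hb hd]

/-- The permutations that avoid `132`, with the final increasing run as statistic. -/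
theorem runDecomposition_avoids132 :
    RunDecomposition (permsWith Avoids132) (derangementsWith Avoids132) finalRun where
  zero := by
    have h : Avoids132 id := fun i j k hij hjk ⟨h1, h2⟩ => by simp only [id] at h1 h2; omega
    exact ⟨id, permsWith_zero h, derangementsWith_zero h, Nat.le_zero.1 (finalRun_le 0 _)⟩
  sum_succ n φ := by
    rw [sum_permsWith_succ (J := fun g => (range (finalRun n g + 1)).image (n - ·))]
    · refine sum_congr rfl fun g _ => ?_
      have := finalRun_le n g
      rw [sum_image (fun x hx y hy hxy => by simp at hx hy hxy; omega)]
      refine sum_congr rfl fun l hl => ?_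
      rw [mem_range] at hl
      rw [finalRun_insertZero (by omega)]
    · intro g _ p hp
      grind
    · intro g hg p hp
      have := finalRun_le n g
      rw [avoids132_insertZero hg hp, ← le_finalRun_iff (by omega), mem_image]
      refine and_congr_right fun _ => ⟨fun h => ⟨n - p, mem_range.2 (by omega), by omega⟩, ?_⟩
      rintro ⟨l, hl, rfl⟩
      rw [mem_range] at hl
      omega
  sum_eq_derangements n φ := sum_avoids132_fixed n φ

end Avoiding132

/-! ### Words with a prescribed set of positive positions -/

section Words

open Finset

variable {n : ℕ}

/-- The number of elements of `S` before position `i`. -/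
def rankIn (S : Finset (Fin n)) (i : Fin n) : ℕ := #{j ∈ S | j < i}

lemma rankIn_mono (S : Finset (Fin n)) {i j : Fin n} (h : i ≤ j) : rankIn S i ≤ rankIn S j :=
  card_le_card fun x hx => by
    rw [mem_filter] at hx ⊢
    exact ⟨hx.1, hx.2.trans_le h⟩

lemma card_filter_le_eq {S : Finset (Fin n)} {i : Fin n} (hi : i ∈ S) :
    #{j ∈ S | j ≤ i} = rankIn S i + 1 := by
  have h : ({j ∈ S | j ≤ i} : Finset (Fin n)) = insert i {j ∈ S | j < i} := by
    ext j
    simp only [mem_filter, mem_insert, le_iff_lt_or_eq]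
    grind
  rw [h, card_insert_of_notMem (by simp), rankIn]

lemma rankIn_lt_card {S : Finset (Fin n)} {i : Fin n} (hi : i ∈ S) : rankIn S i < #S := by
  have := card_filter_le_eq hi
  have := Finset.card_filter_le S (· ≤ i)
  omega

lemma rankIn_le_card (S : Finset (Fin n)) (i : Fin n) : rankIn S i ≤ #S := Finset.card_filter_le _ _

lemma rankIn_lt_rank {S : Finset (Fin n)} {i j : Fin n} (hi : i ∈ S) (h : i < j) :
    rankIn S i < rankIn S j := by
  have h1 := card_filter_le_eq hi
  have h2 : #{x ∈ S | x ≤ i} ≤ rankIn S j := card_le_card fun x hx => by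
    rw [mem_filter] at hx ⊢
    exact ⟨hx.1, hx.2.trans_lt h⟩
  omega

lemma rankIn_lt_rank_iff {S : Finset (Fin n)} {i j : Fin n} (hi : i ∈ S) :
    rankIn S i < rankIn S j ↔ i < j := by
  refine ⟨fun h => ?_, rankIn_lt_rank hi⟩
  by_contra hle
  have := rankIn_mono S (not_lt.1 hle)
  omega

lemma rankIn_injOn (S : Finset (Fin n)) : Set.InjOn (rankIn S) S := by
  intro i hi j hj h
  rcases lt_trichotomy i j with hij | hij | hij
  · have := rankIn_lt_rank hi hij
    omega
  · exact hij
  · have := rankIn_lt_rank hj hij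
    omega

lemma exists_rank_eq {S : Finset (Fin n)} {t : ℕ} (ht : t < #S) : ∃ i ∈ S, rankIn S i = t := by
  have h : S.image (rankIn S) = range #S := by
    refine eq_of_subset_of_card_le (fun x hx => ?_) ?_
    · obtain ⟨i, hi, rfl⟩ := mem_image.1 hx
      exact mem_range.2 (rankIn_lt_card hi)
    · rw [card_image_of_injOn (rankIn_injOn S), card_range]
  simpa [← h] using mem_range.2 ht

lemma rankIn_add_rank_compl (S : Finset (Fin n)) (i : Fin n) : rankIn S i + rankIn Sᶜ i = i := by
  have h : #{j : Fin n | j < i} = (i : ℕ) := by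
    rw [← Fin.card_Iio i]
    congr 1
    ext j
    simp
  rw [← h, rankIn, rankIn, ← card_union_of_disjoint]
  · congr 1
    ext j
    simp only [mem_union, mem_filter, mem_compl, mem_univ, true_and]
    tauto
  · rw [disjoint_left]
    intro j h1 h2
    simp only [mem_filter, mem_compl] at h1 h2
    exact h2.1 h1.1

/-- The word with the letters `f 0 + 1, f 1 + 1, …` on the positions in `S`, and `-1` elsewhere. -/
def spreadWord (S : Finset (Fin n)) (f : ℕ → ℕ) : Fin n → ℤ :=
  fun i => if i ∈ S then (f (rankIn S i) : ℤ) + 1 else -1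

lemma spreadWord_of_mem {S : Finset (Fin n)} {i : Fin n} (f : ℕ → ℕ) (hi : i ∈ S) :
    spreadWord S f i = (f (rankIn S i) : ℤ) + 1 := if_pos hi

lemma spreadWord_of_notMem {S : Finset (Fin n)} {i : Fin n} (f : ℕ → ℕ) (hi : i ∉ S) :
    spreadWord S f i = -1 := if_neg hi

lemma neg_one_le_spreadWord (S : Finset (Fin n)) (f : ℕ → ℕ) (i : Fin n) :
    -1 ≤ spreadWord S f i := by
  unfold spreadWord
  split_ifs <;> omega

lemma mem_of_lt_spreadWord {S : Finset (Fin n)} {f : ℕ → ℕ} {i j : Fin n}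
    (h : spreadWord S f i < spreadWord S f j) : j ∈ S := by
  by_contra hj
  have := neg_one_le_spreadWord S f i
  rw [spreadWord_of_notMem f hj] at h
  omega

lemma spreadWord_injective {S S' : Finset (Fin n)} {f f' : ℕ → ℕ} (hf : f ∈ permSet #S)
    (hf' : f' ∈ permSet #S') (h : spreadWord S f = spreadWord S' f') : S = S' ∧ f = f' := by
  have hS : S = S' := by
    ext i
    have hi := congrFun h i
    unfold spreadWord at hi
    split_ifs at hi <;> tauto
  subst hS
  refine ⟨rfl, funext fun t => ?_⟩
  rcases Nat.lt_or_ge t #S with ht | ht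
  · obtain ⟨i, hi, rfl⟩ := exists_rank_eq ht
    have := congrFun h i
    rw [spreadWord_of_mem f hi, spreadWord_of_mem f' hi] at this
    omega
  · rw [hf.2 t ht, hf'.2 t ht]

/-! ### Derangement forms as words -/

/-- The points that a permutation moves. -/
def nonfixed (π : Equiv.Perm (Fin n)) : Finset (Fin n) := {i | π i ≠ i}

lemma mem_nonfixed {π : Equiv.Perm (Fin n)} {i : Fin n} : i ∈ nonfixed π ↔ π i ≠ i := by
  simp [nonfixed]

lemma apply_mem_nonfixed {π : Equiv.Perm (Fin n)} {i : Fin n} :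
    π i ∈ nonfixed π ↔ i ∈ nonfixed π := by
  simp [mem_nonfixed]

lemma derangementForm_apply (a : KArrangement 1 n) (i : Fin n) :
    derangementForm a i =
      if i ∈ nonfixed a.1 then (rankIn (nonfixed a.1) (a.1 i) : ℤ) + 1 else -1 := by
  obtain ⟨π, φ⟩ := a
  set u : Fin n → ℤ := fun i => if h : π i = i then (φ ⟨i, h⟩ : ℤ) else ((π i : ℕ) : ℤ) + 1 with hu
  have hfix : ∀ i, i ∉ nonfixed π → u i = -1 := by
    intro i hi
    have h : π i = i := not_not.1 (mem_nonfixed.not.1 hi)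
    have h1 := (φ ⟨i, h⟩).2
    rw [Set.mem_Icc] at h1
    simp only [hu, dif_pos h]
    push_cast at h1
    omega
  have hnon : ∀ i, i ∈ nonfixed π → u i = ((π i : ℕ) : ℤ) + 1 := fun i hi => by
    simp only [hu, dif_neg (mem_nonfixed.1 hi)]
  change wordPosRed u i = _
  unfold wordPosRed
  split_ifs with h1 h2 h2
  · have himage : ((univ.image u).filter fun x => 0 < x ∧ x ≤ u i) =
        image (fun x : Fin n => ((x : ℕ) : ℤ) + 1) {x ∈ nonfixed π | x ≤ π i} := by
      ext x
      simp only [mem_filter, mem_image, mem_univ, true_and, hnon i h2]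
      constructor
      · rintro ⟨⟨j, rfl⟩, hpos, hle⟩
        have hj : j ∈ nonfixed π := by
          by_contra hj
          rw [hfix j hj] at hpos
          omega
        rw [hnon j hj] at hle ⊢
        exact ⟨π j, ⟨apply_mem_nonfixed.2 hj, Fin.le_def.2 (by omega)⟩, rfl⟩
      · rintro ⟨y, ⟨hy, hle⟩, rfl⟩
        have hle := Fin.le_def.1 hle
        have hj : π.symm y ∈ nonfixed π := by
          rw [← apply_mem_nonfixed, Equiv.apply_symm_apply]
          exact hy
        refine ⟨⟨π.symm y, ?_⟩, by omega, by omega⟩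
        rw [hnon _ hj, Equiv.apply_symm_apply]
    rw [himage, card_image_of_injective, card_filter_le_eq (apply_mem_nonfixed.2 h2)]
    · push_cast
      rfl
    · intro x y hxy
      simp only at hxy
      exact Fin.ext (by omega)
  · rw [hfix i h2] at h1
    omega
  · rw [hnon i h2] at h1
    omega
  · exact hfix i h2

/-- The derangement forms are the spread derangements: relabel the nonfixed points of an arrangement
by their rank. -/
lemma mem_derangementForms_iff {w : Fin n → ℤ} :
    w ∈ derangementForms 1 n ↔ ∃ (S : Finset (Fin n)) (f : ℕ → ℕ),
      f ∈ permSet #S ∧ (∀ t < #S, f t ≠ t) ∧ spreadWord S f = w := by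
  constructor
  · rintro ⟨a, rfl⟩
    set S := nonfixed a.1 with hS
    choose! e he hr using fun (t : Fin #S) => exists_rank_eq t.2
    have hmem : ∀ t, a.1 (e t) ∈ S := fun t => apply_mem_nonfixed.2 (he t)
    have hlt : ∀ t, rankIn S (a.1 (e t)) < #S := fun t => rankIn_lt_card (hmem t)
    refine ⟨S, fun t => if h : t < #S then rankIn S (a.1 (e ⟨t, h⟩)) else t,
      ⟨fun s t hst => ?_, fun t ht => dif_neg (by omega)⟩, fun t ht h => ?_, ?_⟩
    · simp only at hst
      split_ifs at hst with h1 h2 h2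
      · have h3 := a.1.injective (rankIn_injOn S (hmem _) (hmem _) hst)
        have h4 := congrArg (rankIn S) h3
        rwa [hr, hr] at h4
      · have := hlt ⟨s, h1⟩
        omega
      · have := hlt ⟨t, h2⟩
        omega
      · exact hst
    · simp only [dif_pos ht] at h
      have h1 : rankIn S (a.1 (e ⟨t, ht⟩)) = rankIn S (e ⟨t, ht⟩) := by rw [hr, h]
      exact mem_nonfixed.1 (he ⟨t, ht⟩) (rankIn_injOn S (hmem _) (he _) h1)
    · funext i
      rw [derangementForm_apply, ← hS]
      by_cases hi : i ∈ S
      · have he' : e ⟨rankIn S i, rankIn_lt_card hi⟩ = i := rankIn_injOn S (he _) hi (hr _)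
        rw [spreadWord_of_mem _ hi, if_pos hi]
        simp only [dif_pos (rankIn_lt_card hi), he']
      · rw [spreadWord_of_notMem _ hi, if_neg hi]
  · rintro ⟨S, f, hf, hd, rfl⟩
    choose! e he hr using fun (t : Fin #S) => exists_rank_eq t.2
    have hlt : ∀ i ∈ S, f (rankIn S i) < #S := fun i hi => lt_of_mem_permSet hf (rankIn_lt_card hi)
    let p : Fin n → Fin n := fun i => if h : i ∈ S then e ⟨f (rankIn S i), hlt i h⟩ else i
    have hp : ∀ i (h : i ∈ S), p i = e ⟨f (rankIn S i), hlt i h⟩ := fun i h => dif_pos h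
    have hp' : ∀ i, i ∉ S → p i = i := fun i h => dif_neg h
    have hrank : ∀ i ∈ S, rankIn S (p i) = f (rankIn S i) := fun i hi => by rw [hp i hi, hr]
    have hmem : ∀ i, p i ∈ S ↔ i ∈ S := fun i => by
      by_cases h : i ∈ S
      · simp only [hp i h, he, h]
      · rw [hp' i h]
    have hinj : Function.Injective p := by
      intro i j hij
      have h1 := hmem i
      rw [hij, hmem j] at h1
      by_cases h : i ∈ S
      · refine rankIn_injOn S h (h1.2 h) (hf.1 ?_)
        rw [← hrank i h, ← hrank j (h1.2 h), hij]
      · rwa [hp' i h, hp' j (h1.not.2 h)] at hij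
    let π : Equiv.Perm (Fin n) := Equiv.ofBijective p (Finite.injective_iff_bijective.1 hinj)
    have hnon : nonfixed π = S := by
      ext i
      rw [mem_nonfixed]
      change p i ≠ i ↔ i ∈ S
      by_cases h : i ∈ S
      · simp only [h, iff_true]
        intro hi
        have := hrank i h
        rw [hi] at this
        exact hd _ (rankIn_lt_card h) this.symm
      · simp [hp' i h, h]
    refine ⟨⟨π, fun _ => ⟨-1, by simp⟩⟩, funext fun i => ?_⟩
    rw [derangementForm_apply, hnon]
    unfold spreadWord
    split_ifs with h
    · change (rankIn S (p i) : ℤ) + 1 = _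
      rw [hrank i h]
    · rfl

/-! ### Occurrences of the two patterns -/

lemma lt_of_wordRed_lt {m : ℕ} {u : Fin m → ℤ} {i j : Fin m} (h : wordRed u i < wordRed u j) :
    u i < u j := by
  by_contra hle
  refine absurd h (not_lt.2 ?_)
  unfold wordRed
  exact_mod_cast card_le_card fun x hx => by
    rw [mem_filter] at hx ⊢
    exact ⟨hx.1, hx.2.trans (not_lt.1 hle)⟩

lemma image_univ_fin_three (u : Fin 3 → ℤ) : univ.image u = {u 0, u 1, u 2} := by
  ext x
  simp [Fin.exists_fin_succ, eq_comm]

lemma wordRed_eq_321 {u : Fin 3 → ℤ} : wordRed u = ![3, 2, 1] ↔ u 2 < u 1 ∧ u 1 < u 0 := by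
  refine ⟨fun h => ⟨lt_of_wordRed_lt ?_, lt_of_wordRed_lt ?_⟩, fun ⟨h1, h2⟩ => ?_⟩
  · simp [h]
  · simp [h]
  · have h3 := h1.trans h2
    funext i
    unfold wordRed
    rw [image_univ_fin_three]
    fin_cases i <;>
    simp [filter_insert, filter_singleton, h1.le, h2.le, h3.le, h1.not_ge, h2.not_ge, h3.not_ge,
      h1.ne', h2.ne', h3.ne']

lemma wordRed_eq_132 {u : Fin 3 → ℤ} : wordRed u = ![1, 3, 2] ↔ u 0 < u 2 ∧ u 2 < u 1 := by
  refine ⟨fun h => ⟨lt_of_wordRed_lt ?_, lt_of_wordRed_lt ?_⟩, fun ⟨h1, h2⟩ => ?_⟩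
  · simp [h]
  · simp [h]
  · have h3 := h1.trans h2
    funext i
    unfold wordRed
    rw [image_univ_fin_three]
    fin_cases i <;>
    simp [filter_insert, filter_singleton, h1.le, h2.le, h3.le, h1.not_ge, h2.not_ge, h3.not_ge,
      h1.ne, h3.ne, h2.ne']

lemma strictMono_fin_three {a b c : Fin n} (hab : a < b) (hbc : b < c) :
    StrictMono ![a, b, c] := by
  rw [Fin.strictMono_iff_lt_succ]
  intro i
  fin_cases i <;> simpa

lemma avoidsPattern_321_iff {w : Fin n → ℤ} :
    AvoidsPattern w ![3, 2, 1] ↔ ∀ a b c, a < b → b < c → ¬ (w c < w b ∧ w b < w a) := by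
  unfold AvoidsPattern
  simp only [wordRed_eq_321]
  refine ⟨fun h a b c hab hbc hw => h ⟨![a, b, c], strictMono_fin_three hab hbc, hw⟩, ?_⟩
  rintro h ⟨f, hf, hw⟩
  exact h (f 0) (f 1) (f 2) (hf (by decide)) (hf (by decide)) hw

lemma avoidsPattern_132_iff {w : Fin n → ℤ} :
    AvoidsPattern w ![1, 3, 2] ↔ ∀ a b c, a < b → b < c → ¬ (w a < w c ∧ w c < w b) := by
  unfold AvoidsPattern
  simp only [wordRed_eq_132]
  refine ⟨fun h a b c hab hbc hw => h ⟨![a, b, c], strictMono_fin_three hab hbc, hw⟩, ?_⟩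
  rintro h ⟨f, hf, hw⟩
  exact h (f 0) (f 1) (f 2) (hf (by decide)) (hf (by decide)) hw

lemma spreadWord_avoids_321_iff {S : Finset (Fin n)} {f : ℕ → ℕ} (hf : f ∈ permSet #S) :
    AvoidsPattern (spreadWord S f) ![3, 2, 1] ↔
      Avoids321 f ∧ ∀ i ∉ S, InitialIncreasing f (rankIn S i) := by
  rw [avoidsPattern_321_iff]
  refine ⟨fun h => ⟨fun r s t hrs hst ⟨h1, h2⟩ => ?_, fun i hi s t hst ht => ?_⟩, ?_⟩
  · have ht : t < #S := by
      by_contra ht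
      have h3 := hf.2 t (by omega)
      have h4 := hf.2 s
      have h5 := lt_of_mem_permSet hf (i := s)
      omega
    obtain ⟨c, hc, rfl⟩ := exists_rank_eq ht
    obtain ⟨b, hb, rfl⟩ := exists_rank_eq (hst.trans ht)
    obtain ⟨a, ha, rfl⟩ := exists_rank_eq (hrs.trans (hst.trans ht))
    refine h a b c ((rankIn_lt_rank_iff ha).1 hrs) ((rankIn_lt_rank_iff hb).1 hst) ?_
    simp only [spreadWord_of_mem f ha, spreadWord_of_mem f hb, spreadWord_of_mem f hc]
    omega
  · have htS := ht.trans_le (rankIn_le_card S i)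
    obtain ⟨b, hb, rfl⟩ := exists_rank_eq htS
    obtain ⟨a, ha, rfl⟩ := exists_rank_eq (hst.trans htS)
    have h1 := h a b i ((rankIn_lt_rank_iff ha).1 hst) ((rankIn_lt_rank_iff hb).1 ht)
    have h2 : f (rankIn S a) ≠ f (rankIn S b) := fun e => hst.ne (hf.1 e)
    simp only [spreadWord_of_mem f ha, spreadWord_of_mem f hb, spreadWord_of_notMem f hi] at h1
    omega
  · rintro ⟨hA, hI⟩ a b c hab hbc ⟨h1, h2⟩
    have ha := mem_of_lt_spreadWord h2
    have hb := mem_of_lt_spreadWord h1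
    have hab' := rankIn_lt_rank ha hab
    have hbc' := rankIn_lt_rank hb hbc
    rw [spreadWord_of_mem f ha, spreadWord_of_mem f hb] at h2
    by_cases hc : c ∈ S
    · rw [spreadWord_of_mem f hc, spreadWord_of_mem f hb] at h1
      exact hA _ _ _ hab' hbc' ⟨by omega, by omega⟩
    · have := hI c hc _ _ hab' hbc'
      omega

lemma spreadWord_avoids_132_iff {S : Finset (Fin n)} {f : ℕ → ℕ} (hf : f ∈ permSet #S) :
    AvoidsPattern (spreadWord S f) ![1, 3, 2] ↔
      Avoids132 f ∧ ∀ i ∉ S, FinalIncreasing #S f (#S - rankIn S i) := by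
  rw [avoidsPattern_132_iff]
  refine ⟨fun h => ⟨fun r s t hrs hst ⟨h1, h2⟩ => ?_, fun i hi s t hs hst ht => ?_⟩, ?_⟩
  · have ht : t < #S := by
      by_contra ht
      have h3 := hf.2 t (by omega)
      have h4 := hf.2 s
      have h5 := lt_of_mem_permSet hf (i := s)
      omega
    obtain ⟨c, hc, rfl⟩ := exists_rank_eq ht
    obtain ⟨b, hb, rfl⟩ := exists_rank_eq (hst.trans ht)
    obtain ⟨a, ha, rfl⟩ := exists_rank_eq (hrs.trans (hst.trans ht))
    refine h a b c ((rankIn_lt_rank_iff ha).1 hrs) ((rankIn_lt_rank_iff hb).1 hst) ?_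
    simp only [spreadWord_of_mem f ha, spreadWord_of_mem f hb, spreadWord_of_mem f hc]
    omega
  · obtain ⟨c, hc, rfl⟩ := exists_rank_eq ht
    obtain ⟨b, hb, rfl⟩ := exists_rank_eq (hst.trans ht)
    have hib : i < b := by
      by_contra hle
      rcases (not_lt.1 hle).lt_or_eq with hlt | rfl
      · have := rankIn_lt_rank hb hlt
        omega
      · exact hi hb
    have h1 := h i b c hib ((rankIn_lt_rank_iff hb).1 hst)
    have h2 : f (rankIn S b) ≠ f (rankIn S c) := fun e => hst.ne (hf.1 e)
    simp only [spreadWord_of_mem f hb, spreadWord_of_mem f hc, spreadWord_of_notMem f hi] at h1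
    omega
  · rintro ⟨hA, hI⟩ a b c hab hbc ⟨h1, h2⟩
    have hb := mem_of_lt_spreadWord h2
    have hc := mem_of_lt_spreadWord h1
    have hbc' := rankIn_lt_rank hb hbc
    rw [spreadWord_of_mem f hb, spreadWord_of_mem f hc] at h2
    by_cases ha : a ∈ S
    · rw [spreadWord_of_mem f ha, spreadWord_of_mem f hc] at h1
      exact hA _ _ _ (rankIn_lt_rank ha hab) hbc' ⟨by omega, by omega⟩
    · have h3 := rankIn_mono S hab.le
      have := hI a ha _ _ (by omega) hbc' (rankIn_lt_card hc)
      omega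

/-- It suffices to look at the last position outside of `S`. -/
lemma rankIn_le_iff {S : Finset (Fin n)} {L : ℕ} :
    (∀ i ∉ S, rankIn S i ≤ L) ↔ ∀ i ∉ S, (i : ℕ) < L + #Sᶜ := by
  refine ⟨fun h i hi => ?_, fun h i hi => ?_⟩
  · have h1 := rankIn_add_rank_compl S i
    have h2 := rankIn_lt_card (mem_compl.2 hi)
    have h3 := h i hi
    omega
  · have h1 := rankIn_lt_card (mem_compl.2 hi)
    obtain ⟨j, hj, hjr⟩ := exists_rank_eq (S := Sᶜ) (t := #Sᶜ - 1) (by omega)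
    have h2 := rankIn_add_rank_compl S j
    have h3 := h j (mem_compl.1 hj)
    have hij : i ≤ j := by
      by_contra hlt
      have := rankIn_lt_rank hj (not_le.1 hlt)
      omega
    have h4 := rankIn_mono S hij
    omega

/-- It suffices to look at the first position outside of `S`. -/
lemma card_sub_rank_le_iff {S : Finset (Fin n)} {L : ℕ} :
    (∀ i ∉ S, #S - rankIn S i ≤ L) ↔ ∀ i ∉ S, n ≤ i + (L + #Sᶜ) := by
  have hn : #S + #Sᶜ = n := by rw [card_add_card_compl, Fintype.card_fin]
  refine ⟨fun h i hi => ?_, fun h i hi => ?_⟩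
  · have h1 := rankIn_add_rank_compl S i
    have h3 := h i hi
    omega
  · have h1 := rankIn_lt_card (mem_compl.2 hi)
    obtain ⟨j, hj, hjr⟩ := exists_rank_eq (S := Sᶜ) (t := 0) (by omega)
    have h2 := rankIn_add_rank_compl S j
    have h3 := h j (mem_compl.1 hj)
    have hij : j ≤ i := by
      by_contra hlt
      have := rankIn_lt_rank (mem_compl.2 hi) (not_le.1 hlt)
      omega
    have h4 := rankIn_mono S hij
    omega

/-- The words obtained by spreading the derangements `f` that satisfy `A`, where the letters `-1`
are confined to a set of positions of size `L f` plus the number of these letters. -/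
lemma ncard_spreadWords {A : (ℕ → ℕ) → Prop} {L : ℕ → (ℕ → ℕ) → ℕ} (hL : ∀ m f, L m f ≤ m)
    {T : ℕ → Finset (Fin n)} (hT : ∀ r ≤ n, #(T r) = r) {W : Set (Fin n → ℤ)}
    (hW : ∀ w, w ∈ W ↔ ∃ (S : Finset (Fin n)) (f : ℕ → ℕ), f ∈ derangementsWith A #S ∧
      Sᶜ ⊆ T (L #S f + #Sᶜ) ∧ spreadWord S f = w) :
    W.ncard = wordCount (derangementsWith A) L n := by
  have hcompl : ∀ Z : Finset (Fin n), #Zᶜ + #Z = n := fun Z => by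
    rw [add_comm, card_add_card_compl, Fintype.card_fin]
  let X := (antidiagonal n).sigma fun p => (derangementsWith A p.1).sigma fun f =>
    powersetCard p.2 (T (L p.1 f + p.2))
  have hX : ∀ p f Z, (⟨p, f, Z⟩ : (_ : ℕ × ℕ) × (_ : ℕ → ℕ) × Finset (Fin n)) ∈ X ↔
      p = (#Zᶜ, #Z) ∧ f ∈ derangementsWith A #Zᶜ ∧ Z ⊆ T (L #Zᶜ f + #Z) := by
    rintro ⟨x, y⟩ f Z
    have := hcompl Z
    simp only [X, mem_sigma, HasAntidiagonal.mem_antidiagonal, mem_powersetCard, Prod.mk.injEq]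
    constructor
    · rintro ⟨h1, h2, h3, rfl⟩
      obtain rfl : x = #Zᶜ := by omega
      exact ⟨⟨rfl, rfl⟩, h2, h3⟩
    · rintro ⟨⟨rfl, rfl⟩, h2, h3⟩
      exact ⟨this, h2, h3, rfl⟩
  have hWX : W = (fun x : (_ : ℕ × ℕ) × (_ : ℕ → ℕ) × Finset (Fin n) =>
      spreadWord x.2.2ᶜ x.2.1) '' (X : Set _) := by
    ext w
    rw [hW, Set.mem_image]
    constructor
    · rintro ⟨S, f, hf, hS, rfl⟩
      refine ⟨⟨(#S, #Sᶜ), f, Sᶜ⟩, ?_, by simp only [compl_compl]⟩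
      rw [mem_coe, hX, compl_compl]
      exact ⟨rfl, hf, hS⟩
    · rintro ⟨⟨p, f, Z⟩, hx, rfl⟩
      rw [mem_coe, hX] at hx
      exact ⟨Zᶜ, f, hx.2.1, by simpa using hx.2.2, rfl⟩
  rw [hWX, Set.InjOn.ncard_image, Set.ncard_coe_finset, card_sigma, wordCount]
  · refine sum_congr rfl fun p hp => ?_
    rw [card_sigma]
    refine sum_congr rfl fun f _ => ?_
    have := hL p.1 f
    have := HasAntidiagonal.mem_antidiagonal.1 hp
    rw [card_powersetCard, hT _ (by omega)]
  · rintro ⟨p, f, Z⟩ hx ⟨p', f', Z'⟩ hx' h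
    rw [mem_coe, hX] at hx hx'
    obtain ⟨h1, h2⟩ := spreadWord_injective (mem_derangementsWith.1 hx.2.1).1
      (mem_derangementsWith.1 hx'.2.1).1 h
    obtain rfl : Z = Z' := compl_injective h1
    obtain rfl : f = f' := h2
    rw [hx.1, hx'.1]

theorem ncard_avoiders_321 (n : ℕ) :
    (avoiders (derangementForms 1 n) ![3, 2, 1]).ncard =
      wordCount (derangementsWith Avoids321) initialRun n := by
  refine ncard_spreadWords initialRun_le (T := fun r => {i : Fin n | (i : ℕ) < r})
    (fun r hr => ?_) fun w => ?_
  · rw [Fin.card_filter_val_lt, min_eq_right hr]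
  · have key : ∀ (S : Finset (Fin n)) f, f ∈ permSet #S →
        ((∀ i ∉ S, InitialIncreasing f (rankIn S i)) ↔
        Sᶜ ⊆ ({i : Fin n | (i : ℕ) < initialRun #S f + #Sᶜ} : Finset (Fin n))) := by
      intro S f hf
      simp only [subset_iff, mem_compl, mem_filter, mem_univ, true_and, ← rankIn_le_iff,
        le_initialRun_iff (rankIn_le_card S _)]
    simp only [avoiders, Set.mem_ofPred_eq, mem_derangementForms_iff, mem_derangementsWith]
    constructor
    · rintro ⟨⟨S, f, hf, hd, rfl⟩, hw⟩
      rw [spreadWord_avoids_321_iff hf, key S f hf] at hw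
      exact ⟨S, f, ⟨hf, hw.1, hd⟩, hw.2, rfl⟩
    · rintro ⟨S, f, ⟨hf, hA, hd⟩, hS, rfl⟩
      refine ⟨⟨S, f, hf, hd, rfl⟩, ?_⟩
      rw [spreadWord_avoids_321_iff hf, key S f hf]
      exact ⟨hA, hS⟩

theorem ncard_avoiders_132 (n : ℕ) :
    (avoiders (derangementForms 1 n) ![1, 3, 2]).ncard =
      wordCount (derangementsWith Avoids132) finalRun n := by
  refine ncard_spreadWords finalRun_le (T := fun r => {i : Fin n | n ≤ (i : ℕ) + r})
    (fun r hr => ?_) fun w => ?_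
  · have h := card_filter_add_card_filter_not (s := (univ : Finset (Fin n)))
      (fun i : Fin n => (i : ℕ) < n - r)
    rw [Fin.card_filter_val_lt, card_univ, Fintype.card_fin] at h
    have h' : univ.filter (fun i : Fin n => n ≤ (i : ℕ) + r) =
        univ.filter fun i : Fin n => ¬ (i : ℕ) < n - r := by
      ext i
      simp only [mem_filter, mem_univ, true_and]
      omega
    rw [h']
    omega
  · have key : ∀ (S : Finset (Fin n)) f, f ∈ permSet #S →
        ((∀ i ∉ S, FinalIncreasing #S f (#S - rankIn S i)) ↔
        Sᶜ ⊆ ({i : Fin n | n ≤ (i : ℕ) + (finalRun #S f + #Sᶜ)} : Finset (Fin n))) := by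
      intro S f hf
      simp only [subset_iff, mem_compl, mem_filter, mem_univ, true_and, ← card_sub_rank_le_iff,
        le_finalRun_iff (Nat.sub_le _ _)]
    simp only [avoiders, Set.mem_ofPred_eq, mem_derangementForms_iff, mem_derangementsWith]
    constructor
    · rintro ⟨⟨S, f, hf, hd, rfl⟩, hw⟩
      rw [spreadWord_avoids_132_iff hf, key S f hf] at hw
      exact ⟨S, f, ⟨hf, hw.1, hd⟩, hw.2, rfl⟩
    · rintro ⟨S, f, ⟨hf, hA, hd⟩, hS, rfl⟩
      refine ⟨⟨S, f, hf, hd, rfl⟩, ?_⟩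
      rw [spreadWord_avoids_132_iff hf, key S f hf]
      exact ⟨hA, hS⟩

end Words

/-- The two assertions: the Wilf-equivalence for every `n ≥ 1`, and the formula for the generating
function, read in the field of formal Laurent series over `ℚ`; `s` is the power series
`√(1 - 4x)`, the unique square root of `1 - 4x` with constant term `1`. -/
theorem theorem1p3 :
    (∀ n : ℕ, 1 ≤ n → WilfEquivalent (derangementForms 1 n) ![3, 2, 1] ![1, 3, 2]) ∧
    (∃ s : PowerSeries ℚ, PowerSeries.constantCoeff s = 1 ∧ s ^ 2 = 1 - 4 * PowerSeries.X ∧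
      ((genFun (fun n => (avoiders (derangementForms 1 n) ![3, 2, 1]).ncard) : PowerSeries ℚ) :
          LaurentSeries ℚ) =
        ((1 - 3 * PowerSeries.X + 3 * PowerSeries.X ^ 2 + 2 * PowerSeries.X ^ 3
            + (PowerSeries.X ^ 2 + PowerSeries.X - 1) * s : PowerSeries ℚ) : LaurentSeries ℚ) /
        ((2 * PowerSeries.X ^ 2 * (1 - PowerSeries.X) * (2 + PowerSeries.X) : PowerSeries ℚ) :
          LaurentSeries ℚ)) := by
  refine ⟨fun n _ => ?_, ?_⟩
  · rw [WilfEquivalent, ncard_avoiders_321, ncard_avoiders_132]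
    exact runDecomposition_avoids321.wordCount_unique runDecomposition_avoids132 n
  · obtain ⟨s, hs, hs2, hF⟩ := runDecomposition_avoids321.wordCount_series
    refine ⟨s, hs, hs2, ?_⟩
    have hgen : genFun (fun n => (avoiders (derangementForms 1 n) ![3, 2, 1]).ncard) =
        PowerSeries.mk fun n => (wordCount (derangementsWith Avoids321) initialRun n : ℚ) := by
      refine congrArg PowerSeries.mk (funext fun n => ?_)
      split_ifs with h
      · rw [h, runDecomposition_avoids321.wordCount_zero, Nat.cast_one]
      · exact congrArg Nat.cast (ncard_avoiders_321 n)
    have hne : (2 * PowerSeries.X ^ 2 * (1 - PowerSeries.X) * (2 + PowerSeries.X) :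
        PowerSeries ℚ) ≠ 0 := by
      have h2 : PowerSeries.constantCoeff (2 : PowerSeries ℚ) = 2 := map_ofNat _ 2
      refine mul_ne_zero (mul_ne_zero (mul_ne_zero (fun h => ?_)
        (pow_ne_zero 2 PowerSeries.X_ne_zero)) fun h => ?_) fun h => ?_ <;>
      simpa [h2] using congrArg PowerSeries.constantCoeff h
    rw [hgen, eq_div_iff, ← PowerSeries.coe_mul, hF]
    rw [← PowerSeries.coe_zero]
    exact fun h => hne (HahnSeries.ofPowerSeries_injective h)
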